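/- Let $\Gamma$ be a countable discrete group, let $\lambda,\rho$ be its left and right regular representations on $\ell_2(\Gamma)$, $\lambda(\gamma)\delta_{x}=\delta_{\gamma x}$, $\rho(\gamma)\delta_x=\delta_{x\gamma^{-1}}$, let $\mathscr{R}(\Gamma)$, $\mathscr{L}(\Gamma)$ be the von Neumann algebras generated by $\rho(\Gamma)$ and $\lambda(\Gamma)$, and let $\tau(F)=\langle F\delta_e,\delta_e\rangle$ be the standard trace. For $p\in\{1,2\}$ let $L^p(\mathscr{R}(\Gamma))$ be the space of closed densely defined operators $F$ on $\ell_2(\Gamma)$ that are affiliated with $\mathscr{R}(\Gamma)$ (that is, commute with all unitaries of $\mathscr{L}(\Gamma)$) and satisfy $\|F\|_p=\tau(|F|^p)^{1/p}<\infty$; $\tau$ is extended to $L^1(\mathscr{R}(\Gamma))$ by $\|\cdot\|_1$-continuity. Let $\Pi$ be a unitary representation of $\Gamma$ on a separable Hilbert space $\mathcal H$, and suppose that $(\Gamma,\Pi,\mathcal H)$ is a dual integrable triple, with bracket map $[\cdot,\cdot]:\mathcal H\times\mathcal H\to L^1(\mathscr{R}(\Gamma))$; that is, $[\cdot,\cdot]$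 is sesquilinear and $$\langle\varphi,\Pi(\gamma)\psi\rangle_{\mathcal H}=\tau([\varphi,\psi]\rho(\gamma))\qquad\text{for all }\varphi,\psi\in\mathcal H,\ \gamma\in\Gamma .$$ For $\psi\in\mathcal H$ let $T_\psi c=\sum_{\gamma}c_\gamma\Pi(\gamma)\psi$ be the synthesis operator of the orbit of $\psi$, defined on the space $\ell_0(\Gamma)\subset\ell_2(\Gamma)$ of finitely supported sequences, and let the Gramian $\mathfrak G_\psi$ be the closure of $T_\psi^*T_\psi$, where $T_\psi^*T_\psi$ has domain $\{c\in\ell_0(\Gamma): T_\psi c\in \mathrm{Dom}(T_\psi^*)\}$. Then: (i) If $\psi\in\mathcal H$ is such that $\mathfrak G_\psi$ is a closed and densely defined operator on $\ell_2(\Gamma)$, then $\mathfrak G_\psi\in L^1(\mathscr{R}(\Gamma))$ and $[\psi,\psi]=\mathfrak G_\psi$. (ii) If $\psi\in\mathcal H$ is such that $[\psi,\psi]\in L^2(\mathscr{R}(\Gamma))$, then $T_\psi^*T_\psi$ is defined on all of $\ell_0(\Gamma)$, and $\mathfrak G_\psi$ is a closed and densely defined operator on $\ell_2(\Gamma)$.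 (iii) The set of all $\psi\in\mathcal H$ with $[\psi,\psi]\in L^2(\mathscr{R}(\Gamma))$ and $[\psi,\psi]=\mathfrak G_\psi$ is dense in $\mathcal H$. -/

import Mathlib

open scoped ENNReal

noncomputable section

/-- The Hilbert space `ℓ²(ι)` of square summable complex families. -/
abbrev EllTwo (ι : Type*) : Type _ := lp (fun _ : ι => ℂ) 2

/-! ### Unbounded operators -/

section Unbounded

variable {E F G : Type*} [AddCommGroup E] [Module ℂ E] [AddCommGroup F] [Module ℂ F]
  [AddCommGroup G] [Module ℂ G]

/-- The composition `A B` of two partially defined operators on its natural domain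
`{x ∈ Dom B : B x ∈ Dom A}`. -/
def opComp (A : F →ₗ.[ℂ] G) (B : E →ₗ.[ℂ] F) : E →ₗ.[ℂ] G where
  domain :=
    { carrier := {x | ∃ h : x ∈ B.domain, B ⟨x, h⟩ ∈ A.domain}
      zero_mem' := ⟨B.domain.zero_mem, by
        have h : B ⟨0, B.domain.zero_mem⟩ = 0 := B.map_zero
        rw [h]; exact A.domain.zero_mem⟩
      add_mem' := by
        rintro x y ⟨hx, hx'⟩ ⟨hy, hy'⟩
        refine ⟨B.domain.add_mem hx hy, ?_⟩
        have h : B ⟨x + y, B.domain.add_mem hx hy⟩ = B ⟨x, hx⟩ + B ⟨y, hy⟩ :=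
          B.map_add ⟨x, hx⟩ ⟨y, hy⟩
        rw [h]; exact A.domain.add_mem hx' hy'
      smul_mem' := by
        rintro c x ⟨hx, hx'⟩
        refine ⟨B.domain.smul_mem c hx, ?_⟩
        have h : B ⟨c • x, B.domain.smul_mem c hx⟩ = c • B ⟨x, hx⟩ :=
          B.map_smul c ⟨x, hx⟩
        rw [h]; exact A.domain.smul_mem c hx' }
  toFun :=
    { toFun := fun x => A ⟨B ⟨x.1, x.2.1⟩, x.2.2⟩
      map_add' := by
        rintro ⟨x, hx, hx'⟩ ⟨y, hy, hy'⟩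
        rw [← A.map_add]
        congr 1
        exact Subtype.ext (B.map_add ⟨x, hx⟩ ⟨y, hy⟩)
      map_smul' := by
        rintro c ⟨x, hx, hx'⟩
        rw [RingHom.id_apply, ← A.map_smul]
        congr 1
        exact Subtype.ext (B.map_smul c ⟨x, hx⟩) }

end Unbounded

/-- A bounded operator, viewed as an everywhere defined element of the partially defined ones. -/
def bddOp {E F : Type*} [NormedAddCommGroup E] [NormedSpace ℂ E] [NormedAddCommGroup F]
    [NormedSpace ℂ F] (T : E →L[ℂ] F) : E →ₗ.[ℂ] F :=
  (T : E →ₗ[ℂ] F).toPMap ⊤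

section Positive

variable {K : Type*} [NormedAddCommGroup K] [InnerProductSpace ℂ K] [CompleteSpace K]

/-- Positive selfadjoint (possibly unbounded, hence densely defined and closed) operators. -/
def IsPosSelfAdjoint (S : K →ₗ.[ℂ] K) : Prop :=
  IsSelfAdjoint S ∧ ∀ x : S.domain, 0 ≤ (inner ℂ (x : K) (S x)).re

/-- `S = √P`: the positive selfadjoint operator `S` with `S² = P` (equality of domains
included). -/
def IsOpSqrt (P S : K →ₗ.[ℂ] K) : Prop :=
  IsPosSelfAdjoint S ∧ opComp S S = P

/-- `P = |F| = √(F*F)`. -/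
def IsOpAbs (F P : K →ₗ.[ℂ] K) : Prop :=
  IsOpSqrt (opComp F.adjoint F) P

end Positive

/-! ### Synthesis, analysis and Gramian -/

section Gramian

variable {ι H : Type*} [NormedAddCommGroup H] [InnerProductSpace ℂ H]

/-- `ℓ₀(ι)`, the finitely supported families, as a subspace of `ℓ²(ι)`. -/
def ellZero (ι : Type*) : Submodule ℂ (EllTwo ι) where
  carrier := {c | (Function.support (c : ι → ℂ)).Finite}
  zero_mem' := by
    change (Function.support (0 : ι → ℂ)).Finite
    rw [Function.support_zero]
    exact Set.finite_empty
  add_mem' := by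
    intro a b ha hb
    refine (Set.Finite.union ha hb).subset ?_
    rw [lp.coeFn_add]
    exact Function.support_add _ _
  smul_mem' := by
    intro c a ha
    refine Set.Finite.subset ha ?_
    rw [lp.coeFn_smul]
    exact Function.support_const_smul_subset c _

/-- The synthesis operator `T_Ψ : c ↦ ∑ⱼ cⱼ ψⱼ` of a family `Ψ`, with domain `ℓ₀(ι)`. -/
def synthesis (Ψ : ι → H) : EllTwo ι →ₗ.[ℂ] H where
  domain := ellZero ι
  toFun :=
    { toFun := fun c => ∑ᶠ j, (c : EllTwo ι) j • Ψ j
      map_add' := by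
        rintro ⟨a, ha⟩ ⟨b, hb⟩
        have ha' : (Function.support fun j => a j • Ψ j).Finite :=
          Set.Finite.subset ha (Function.support_smul_subset_left _ _)
        have hb' : (Function.support fun j => b j • Ψ j).Finite :=
          Set.Finite.subset hb (Function.support_smul_subset_left _ _)
        rw [← finsum_add_distrib ha' hb']
        refine finsum_congr fun j => ?_
        change (a j + b j) • Ψ j = _
        rw [add_smul]
      map_smul' := by
        rintro c ⟨a, ha⟩
        have ha' : (Function.support fun j => a j • Ψ j).Finite :=
          Set.Finite.subset ha (Function.support_smul_subset_left _ _)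
        rw [RingHom.id_apply, smul_finsum' c ha']
        refine finsum_congr fun j => ?_
        change (c • a j) • Ψ j = _
        rw [smul_assoc] }

/-- The composition `T_Ψ* T_Ψ` of the analysis and the synthesis operator, on its natural domain
`{c ∈ ℓ₀(ι) : T_Ψ c ∈ Dom(T_Ψ*)}`. -/
def preGramian (Ψ : ι → H) : EllTwo ι →ₗ.[ℂ] EllTwo ι :=
  opComp (synthesis Ψ).adjoint (synthesis Ψ)

/-- The Gramian: the closure of `T_Ψ* T_Ψ`. -/
def gramian (Ψ : ι → H) : EllTwo ι →ₗ.[ℂ] EllTwo ι :=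
  (preGramian Ψ).closure

end Gramian

/-! ### The group von Neumann algebras and their noncommutative `L¹` and `L²` spaces -/

section GroupAlgebra

/-- The operator `u ↦ u ∘ e` on `ℓ²(ι)` given by a permutation `e` of `ι`. -/
def permOp {ι : Type*} (e : Equiv.Perm ι) : EllTwo ι →L[ℂ] EllTwo ι :=
  LinearMap.mkContinuous
    { toFun := fun u => ⟨fun x => u (e x), by
        exact memℓp_gen (((memℓp_gen_iff (by norm_num)).1 (lp.memℓp u)).comp_injective
          e.injective)⟩
      map_add' := fun _ _ => rfl
      map_smul' := fun _ _ => rfl }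
    1 (fun u => by
      rw [one_mul]
      refine le_of_eq ?_
      rw [lp.norm_eq_tsum_rpow (by norm_num), lp.norm_eq_tsum_rpow (by norm_num)]
      congr 1
      exact e.tsum_eq fun x => ‖u x‖ ^ (2 : ℝ≥0∞).toReal)

variable {Γ : Type*} [Group Γ]

/-- The right regular representation, `(ρ(γ)u)(x) = u(xγ)`, so `ρ(γ)δ_x = δ_{xγ⁻¹}`. -/
def rightReg (γ : Γ) : EllTwo Γ →L[ℂ] EllTwo Γ :=
  permOp (Equiv.mulRight γ)

/-- The left regular representation, `(λ(γ)u)(x) = u(γ⁻¹x)`, so `λ(γ)δ_x = δ_{γx}`. -/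
def leftReg (γ : Γ) : EllTwo Γ →L[ℂ] EllTwo Γ :=
  permOp (Equiv.mulLeft γ⁻¹)

variable (Γ) in
/-- The left von Neumann algebra of `Γ`: the bicommutant of the (selfadjoint) set of all `λ(γ)`. -/
def leftVN : Set (EllTwo Γ →L[ℂ] EllTwo Γ) :=
  Set.centralizer (Set.centralizer (Set.range leftReg))

variable (Γ) in
/-- Trigonometric polynomials: the span of all `ρ(γ)`. -/
def trigPoly : Submodule ℂ (EllTwo Γ →L[ℂ] EllTwo Γ) :=
  Submodule.span ℂ (Set.range rightReg)

open Classical in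
variable (Γ) in
/-- The basis vector `δ_e` at the identity of `Γ`. -/
def deltaOne : EllTwo Γ := lp.single 2 (1 : Γ) (1 : ℂ)

/-- The standard trace `τ(T) = ⟨T δ_e, δ_e⟩` on bounded operators. -/
def bddTrace (T : EllTwo Γ →L[ℂ] EllTwo Γ) : ℂ :=
  inner ℂ (deltaOne Γ) (T (deltaOne Γ))

/-- The extension of `τ` to positive selfadjoint operators `P` affiliated with the right von Neumann
algebra, with values in `[0, ∞]`: `τ(P) = ‖P^{1/2} δ_e‖²` (and `∞` if `δ_e ∉ Dom(P^{1/2})`),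
which is `⟨P δ_e, δ_e⟩` for bounded `P` and `∫ t d⟨E(t) δ_e, δ_e⟩` in general, `E` being the
spectral resolution of `P`. The infimum is over the one square root of `P`. -/
def posTrace (P : EllTwo Γ →ₗ.[ℂ] EllTwo Γ) : ℝ≥0∞ :=
  ⨅ (S : EllTwo Γ →ₗ.[ℂ] EllTwo Γ) (_ : IsOpSqrt P S) (h : deltaOne Γ ∈ S.domain),
    ‖S ⟨deltaOne Γ, h⟩‖ₑ ^ 2

/-- `‖F‖₁ = τ(|F|)`. The infimum is over the one operator `|F|`. -/
def oneNorm (F : EllTwo Γ →ₗ.[ℂ] EllTwo Γ) : ℝ≥0∞ :=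
  ⨅ (P : EllTwo Γ →ₗ.[ℂ] EllTwo Γ) (_ : IsOpAbs F P), posTrace P

/-- `‖F‖₂ = τ(|F|²)^{1/2}`, where `|F|² = F*F`. -/
def twoNorm (F : EllTwo Γ →ₗ.[ℂ] EllTwo Γ) : ℝ≥0∞ :=
  posTrace (opComp F.adjoint F) ^ (1 / 2 : ℝ)

/-- `F` is affiliated with the right von Neumann algebra of `Γ`: it is closed, densely defined
and commutes with every unitary of the left von Neumann algebra. -/
structure IsAffiliated (F : EllTwo Γ →ₗ.[ℂ] EllTwo Γ) : Prop where
  closed : F.IsClosed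
  dense : Dense (F.domain : Set (EllTwo Γ))
  comm : ∀ u ∈ leftVN Γ, u ∈ unitary (EllTwo Γ →L[ℂ] EllTwo Γ) →
    ∀ x : F.domain, ∃ h : u x ∈ F.domain, F ⟨u x, h⟩ = u (F x)

/-- `F ∈ L¹`: affiliated with finite `‖·‖₁`. -/
def MemLOne (F : EllTwo Γ →ₗ.[ℂ] EllTwo Γ) : Prop :=
  IsAffiliated F ∧ oneNorm F < ∞

/-- `F ∈ L²`: affiliated with finite `‖·‖₂`. -/
def MemLTwo (F : EllTwo Γ →ₗ.[ℂ] EllTwo Γ) : Prop :=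
  IsAffiliated F ∧ twoNorm F < ∞

/-- `τ(F) = z` for `F ∈ L¹`, where `τ` is extended from the trigonometric polynomials to their
`‖·‖₁`-closure `L¹` by continuity: `z = lim τ(Pₙ)` for trigonometric polynomials `Pₙ` with
`‖F - Pₙ‖₁ → 0`. -/
def HasTrace (F : EllTwo Γ →ₗ.[ℂ] EllTwo Γ) (z : ℂ) : Prop :=
  ∃ P : ℕ → trigPoly Γ,
    Filter.Tendsto (fun n => oneNorm (F - bddOp (P n : EllTwo Γ →L[ℂ] EllTwo Γ)))
      Filter.atTop (nhds 0) ∧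
    Filter.Tendsto (fun n => bddTrace (P n : EllTwo Γ →L[ℂ] EllTwo Γ)) Filter.atTop (nhds z)

/-- `br` is an operator bracket map of the unitary representation `π`, so that `(Γ, π, H)` is a
dual integrable triple: a map `H × H → L¹`, linear in the first and conjugate linear in the second
variable, with `⟨φ, π(γ)ψ⟩ = τ([φ, ψ] ρ(γ))`. Sums and multiples in `L¹` are strong ones, that is,
closures of the pointwise ones. The inner product of Mathlib is conjugate linear in its first
variable, so `⟨φ, π(γ)ψ⟩` is `inner ℂ (π γ ψ) φ`. -/
structure IsBracket {H : Type*} [NormedAddCommGroup H] [InnerProductSpace ℂ H] [CompleteSpace H]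
    (π : Γ →* unitary (H →L[ℂ] H)) (br : H → H → (EllTwo Γ →ₗ.[ℂ] EllTwo Γ)) : Prop where
  mem : ∀ φ ψ, MemLOne (br φ ψ)
  add_left : ∀ φ φ' ψ, br (φ + φ') ψ = (br φ ψ + br φ' ψ).closure
  smul_left : ∀ (a : ℂ) φ ψ, br (a • φ) ψ = (a • br φ ψ).closure
  add_right : ∀ φ ψ ψ', br φ (ψ + ψ') = (br φ ψ + br φ ψ').closure
  smul_right : ∀ (a : ℂ) φ ψ, br φ (a • ψ) = (star a • br φ ψ).closure
  trace : ∀ φ ψ γ, HasTrace (opComp (br φ ψ) (bddOp (rightReg γ)))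
    (inner ℂ ((π γ : H →L[ℂ] H) ψ) φ)

/-- The orbit `{π(γ)ψ}` of a vector. -/
def orbitFamily {H : Type*} [NormedAddCommGroup H] [InnerProductSpace ℂ H] [CompleteSpace H]
    (π : Γ →* unitary (H →L[ℂ] H)) (ψ : H) : Γ → H :=
  fun γ => (π γ : H →L[ℂ] H) ψ

end GroupAlgebra

end

noncomputable section

open Filter Topology

set_option linter.unusedSectionVars false

/-! Two principles carry the proof. The first is finiteness of the commutant of `λ`: since `‖A* δ_e‖
= ‖A δ_e‖` there, its isometries are unitary. Consequently a closed `λ`-invariant operator is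
maximal: a `λ`-invariant subspace of its graph whose first projection is dense is already dense in
the graph (`le_topologicalClosure_of_invariant`). Symmetric closed invariant operators are therefore
selfadjoint, inclusions between closed densely defined invariant operators are equalities, and
`ℓ₀(Γ)` is a core as soon as `δ_e` is in the domain.

The second is that `F = [ψ,ψ]` is the square of a positive `S` which sees the Gram matrix of the
orbit. Finiteness of `‖F‖₁` gives `F = U S S` with a contraction `U` and `s = S δ_e`, and continuity
of the trace turns the bracket identity into `⟨π(a)ψ, π(b)ψ⟩ = ⟨λ(a)s, λ(b)(Us)*⟩`
(`HasTrace.eq_inner`). The left side is a positive definite kernel. As `ℓ₀(Γ)` is a common core of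
`S` and `S U*`, positivity passes to `F` (`IsPolarFactor.isPosSelfAdjoint`). Hence `F = |F| = S²`,
and the orbits of `ψ` and of `s` have the same Gram matrix.

It follows that `T_ψ* T_ψ` is the restriction of `F` to `ℓ₀(Γ) ∩ Dom F`, so maximality gives (i). In
(ii), membership in `L²` puts `δ_e`, hence `ℓ₀(Γ)`, into `Dom F`. For (iii), let `V` map `λ(a)s` to
`π(a)ψ`. The bounded intertwiners `Θ = V S (1 + ε S²)⁻¹` satisfy `Θ δ_e → V s = ψ`, and the orbit of
`Θ δ_e` has the bounded Gramian `Θ*Θ`, which equals the bracket by (i). -/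

theorem inner_self_eq_ofReal_norm_sq {E : Type*} [NormedAddCommGroup E] [InnerProductSpace ℂ E]
    (x : E) : inner ℂ x x = ((‖x‖ ^ 2 : ℝ) : ℂ) := by
  rw [inner_self_eq_norm_sq_to_K, Complex.ofReal_pow]
  rfl

/-! ### Closed operators through their graphs: adjoints and resolvents. -/

section GraphCalculus

variable {E F G : Type*}

section Algebraic

variable [AddCommGroup E] [Module ℂ E] [AddCommGroup F] [Module ℂ F]
  [AddCommGroup G] [Module ℂ G]

theorem LinearPMap.mem_graph_mk {A : E →ₗ.[ℂ] F} {x : E} (h : x ∈ A.domain) :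
    (x, A ⟨x, h⟩) ∈ A.graph :=
  A.mem_graph ⟨x, h⟩

theorem LinearPMap.mem_graph_pair {A : E →ₗ.[ℂ] F} {x : E} {y : F} :
    (x, y) ∈ A.graph ↔ ∃ h : x ∈ A.domain, A ⟨x, h⟩ = y := by
  simp [LinearPMap.mem_graph_iff]

theorem LinearPMap.graph_functional (A : E →ₗ.[ℂ] F) {x : E} {y y' : F}
    (h : (x, y) ∈ A.graph) (h' : (x, y') ∈ A.graph) : y = y' :=
  A.mem_graph_snd_inj h h' rfl

theorem LinearPMap.eq_of_mem_graph_iff {A B : E →ₗ.[ℂ] F}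
    (h : ∀ x y, (x, y) ∈ A.graph ↔ (x, y) ∈ B.graph) : A = B :=
  LinearPMap.eq_of_eq_graph (Submodule.ext fun p => h p.1 p.2)

theorem mem_graph_opComp {A : F →ₗ.[ℂ] G} {B : E →ₗ.[ℂ] F} {x : E} {z : G} :
    (x, z) ∈ (opComp A B).graph ↔ ∃ y, (x, y) ∈ B.graph ∧ (y, z) ∈ A.graph := by
  rw [LinearPMap.mem_graph_pair]
  constructor
  · rintro ⟨⟨h, h'⟩, rfl⟩
    exact ⟨_, LinearPMap.mem_graph_mk h, LinearPMap.mem_graph_mk h'⟩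
  · rintro ⟨y, h, h'⟩
    obtain ⟨hx, rfl⟩ := LinearPMap.mem_graph_pair.1 h
    obtain ⟨hy, rfl⟩ := LinearPMap.mem_graph_pair.1 h'
    exact ⟨⟨hx, hy⟩, rfl⟩

end Algebraic

theorem mem_graph_bddOp [NormedAddCommGroup E] [NormedSpace ℂ E] [NormedAddCommGroup F]
    [NormedSpace ℂ F] {T : E →L[ℂ] F} {x : E} {y : F} :
    (x, y) ∈ (bddOp T).graph ↔ T x = y := by
  rw [LinearPMap.mem_graph_pair]
  exact ⟨fun ⟨_, h⟩ => h, fun h => ⟨Submodule.mem_top, h⟩⟩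

theorem mem_graph_sub_bddOp [NormedAddCommGroup E] [NormedSpace ℂ E] [NormedAddCommGroup F]
    [NormedSpace ℂ F] {A : E →ₗ.[ℂ] F} {T : E →L[ℂ] F} {x : E} {y : F} :
    (x, y) ∈ (A - bddOp T).graph ↔ (x, y + T x) ∈ A.graph := by
  rw [LinearPMap.mem_graph_pair, LinearPMap.mem_graph_pair]
  constructor
  · rintro ⟨h, rfl⟩
    refine ⟨h.1, ?_⟩
    rw [LinearPMap.sub_apply]
    exact (sub_add_cancel _ _).symm
  · rintro ⟨h, h'⟩
    refine ⟨⟨h, Submodule.mem_top⟩, ?_⟩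
    rw [LinearPMap.sub_apply]
    exact sub_eq_of_eq_add h'

variable [NormedAddCommGroup E] [InnerProductSpace ℂ E] [CompleteSpace E]
  [NormedAddCommGroup F] [InnerProductSpace ℂ F]

theorem mem_graph_adjoint {A : E →ₗ.[ℂ] F} (hA : Dense (A.domain : Set E)) {y : F} {z : E} :
    (y, z) ∈ A.adjoint.graph ↔ ∀ x w, (x, w) ∈ A.graph → inner ℂ w y = inner ℂ x z := by
  rw [LinearPMap.adjoint_graph_eq_graph_adjoint hA, Submodule.mem_adjoint_iff]
  simp only [sub_eq_zero]

theorem LinearPMap.IsClosed.mem_of_tendsto {A : E →ₗ.[ℂ] F} (hA : A.IsClosed) {u : ℕ → E}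
    {v : ℕ → F} {x : E} {y : F} (hu : Tendsto u atTop (𝓝 x)) (hv : Tendsto v atTop (𝓝 y))
    (h : ∀ n, (u n, v n) ∈ A.graph) : (x, y) ∈ A.graph :=
  _root_.IsClosed.mem_of_tendsto hA (hu.prodMk_nhds hv) (Eventually.of_forall h)

theorem bddOp_isClosed (T : E →L[ℂ] F) : (bddOp T).IsClosed := by
  have : ((bddOp T).graph : Set (E × F)) = {p | T p.1 = p.2} := by
    ext ⟨x, y⟩
    exact mem_graph_bddOp
  rw [LinearPMap.IsClosed, this]
  exact isClosed_eq (T.continuous.comp continuous_fst) continuous_snd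

theorem bddOp_dense (T : E →L[ℂ] F) : Dense ((bddOp T).domain : Set E) := by
  change Dense ((⊤ : Submodule ℂ E) : Set E)
  simp

variable [CompleteSpace F]

theorem bddOp_adjoint (T : E →L[ℂ] F) : (bddOp T).adjoint = bddOp T.adjoint :=
  T.toPMap_adjoint_eq_adjoint_toPMap_of_dense (p := ⊤) (by simp)

/-- The orthogonal projection onto the graph of a closed operator, for the inner product of
`E × F` in which the second summand has weight `ε`. -/
theorem LinearPMap.IsClosed.exists_projection {A : E →ₗ.[ℂ] F} (hA : A.IsClosed) {ε : ℝ}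
    (hε : 0 < ε) : ∃ P : (E × F) →L[ℂ] (E × F), ∀ p, P p ∈ A.graph ∧ ∀ q ∈ A.graph,
      inner ℂ q.1 (p.1 - (P p).1) + ε * inner ℂ q.2 (p.2 - (P p).2) = 0 := by
  set t : ℝ := √ε
  have ht : (t : ℂ) ≠ 0 := by exact_mod_cast (Real.sqrt_pos.2 hε).ne'
  have htt : (t : ℂ) * t = ε := by exact_mod_cast Real.mul_self_sqrt hε.le
  let sc : ℂ → (E × F) →L[ℂ] (E × F) := fun c =>
    (ContinuousLinearMap.fst ℂ E F).prod (c • ContinuousLinearMap.snd ℂ E F)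
  let e := WithLp.prodContinuousLinearEquiv 2 ℂ E F
  let G : Submodule ℂ (WithLp 2 (E × F)) := A.graph.comap
    ((sc (t : ℂ)⁻¹ ∘L e.toContinuousLinearMap : WithLp 2 (E × F) →L[ℂ] (E × F)) :
      WithLp 2 (E × F) →ₗ[ℂ] (E × F))
  have hG : _root_.IsClosed (G : Set (WithLp 2 (E × F))) :=
    _root_.IsClosed.preimage (sc (t : ℂ)⁻¹ ∘L e.toContinuousLinearMap).continuous hA
  have : CompleteSpace G := hG.completeSpace_coe
  refine ⟨(sc (t : ℂ)⁻¹ ∘L e.toContinuousLinearMap) ∘L G.starProjection ∘L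
    (e.symm.toContinuousLinearMap ∘L sc t), fun p => ⟨?_, fun q hq => ?_⟩⟩
  · exact (G.starProjection_apply_mem ((e.symm.toContinuousLinearMap ∘L sc t) p) :)
  · have hq' : e.symm (sc t q) ∈ G := by
      change sc (t : ℂ)⁻¹ (e (e.symm (sc t q))) ∈ A.graph
      rw [e.apply_symm_apply]
      have : sc (t : ℂ)⁻¹ (sc t q) = q :=
        Prod.ext rfl (inv_smul_smul₀ ht q.2)
      rwa [this]
    have h := (Submodule.mem_orthogonal G _).1
      (G.sub_starProjection_mem_orthogonal (e.symm (sc t p))) _ hq'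
    rw [WithLp.prod_inner_apply] at h
    set r := G.starProjection (e.symm (sc t p)) with hr
    have h1 : inner ℂ q.1 (p.1 - r.fst) + t * inner ℂ q.2 ((t : ℂ) • p.2 - r.snd) = 0 := by
      have h0 : inner ℂ q.1 (p.1 - r.fst) + inner ℂ ((t : ℂ) • q.2) ((t : ℂ) • p.2 - r.snd) = 0 :=
        h
      rwa [inner_smul_left, Complex.conj_ofReal] at h0
    have h2 : ((t : ℂ) • p.2 - r.snd) = (t : ℂ) • (p.2 - (t : ℂ)⁻¹ • r.snd) := by
      rw [smul_sub, smul_smul, mul_inv_cancel₀ ht, one_smul]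
    rw [h2, inner_smul_right, ← mul_assoc, htt] at h1
    exact h1

/-- This is `A** ⊆ A`. The residual of `(x, w)` after projection to the graph is orthogonal to the
graph, so up to a rotation it lies in the graph of `A*`. Tested on it, the hypothesis makes the
residual orthogonal to `(x, w)` too, hence zero. -/
theorem mem_graph_of_adjoint {A : E →ₗ.[ℂ] F} (hA : A.IsClosed) (hd : Dense (A.domain : Set E))
    {x : E} {w : F} (h : ∀ y z, (y, z) ∈ A.adjoint.graph → inner ℂ z x = inner ℂ y w) :
    (x, w) ∈ A.graph := by
  obtain ⟨P, hP⟩ := hA.exists_projection one_pos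
  obtain ⟨hm, ho⟩ := hP (x, w)
  set a := (P (x, w)).1 with ha
  set b := (P (x, w)).2 with hb
  have hadj : (w - b, -(x - a)) ∈ A.adjoint.graph := by
    rw [mem_graph_adjoint hd]
    intro y z hyz
    have := ho _ hyz
    simp only [Complex.ofReal_one, one_mul] at this
    rw [inner_neg_right]
    linear_combination this
  have h1 := h _ _ hadj
  have h2 := ho _ hm
  simp only [Complex.ofReal_one, one_mul] at h2
  rw [← ha, ← hb] at h2
  have h4 : inner ℂ (x - a) (x - a) + inner ℂ (w - b) (w - b) = (0 : ℂ) := by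
    have e1 : inner ℂ (x - a) (x - a) = inner ℂ (x - a) x - inner ℂ (x - a) a :=
      inner_sub_right _ _ _
    have e2 : inner ℂ (w - b) (w - b) = inner ℂ (w - b) w - inner ℂ (w - b) b :=
      inner_sub_right _ _ _
    have e3 : inner ℂ (w - b) b = starRingEnd ℂ (inner ℂ b (w - b)) := (inner_conj_symm _ _).symm
    have e4 : inner ℂ (x - a) a = starRingEnd ℂ (inner ℂ a (x - a)) := (inner_conj_symm _ _).symm
    rw [inner_neg_left] at h1
    have h2' := congrArg (starRingEnd ℂ) h2
    rw [map_add, map_zero] at h2'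
    rw [e1, e2, e3, e4]
    linear_combination -h1 - h2'
  have h5 : ‖x - a‖ ^ 2 + ‖w - b‖ ^ 2 = 0 := by
    rw [inner_self_eq_ofReal_norm_sq, inner_self_eq_ofReal_norm_sq] at h4
    exact_mod_cast h4
  have h6 : x - a = 0 := by
    have : ‖x - a‖ ^ 2 = 0 := by nlinarith [sq_nonneg ‖x - a‖, sq_nonneg ‖w - b‖]
    simpa using this
  have h7 : w - b = 0 := by
    have : ‖w - b‖ ^ 2 = 0 := by nlinarith [sq_nonneg ‖x - a‖, sq_nonneg ‖w - b‖]
    simpa using this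
  have : (x, w) = P (x, w) := Prod.ext (sub_eq_zero.1 h6) (sub_eq_zero.1 h7)
  rw [this]
  exact hm

theorem adjoint_domain_dense {A : E →ₗ.[ℂ] F} (hA : A.IsClosed)
    (hd : Dense (A.domain : Set E)) : Dense (A.adjoint.domain : Set F) := by
  rw [Submodule.dense_iff_topologicalClosure_eq_top, Submodule.topologicalClosure_eq_top_iff,
    Submodule.eq_bot_iff]
  intro v hv
  -- A vector `v` orthogonal to `Dom A*` satisfies `v = A** 0 = 0`.
  have : ((0 : E), v) ∈ A.graph := mem_graph_of_adjoint hA hd fun y z hyz => by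
    rw [inner_zero_right]
    exact ((Submodule.mem_orthogonal _ _).1 hv y (LinearPMap.mem_domain_of_mem_graph hyz)).symm
  exact A.graph_fst_eq_zero_snd this rfl

theorem adjoint_adjoint {A : E →ₗ.[ℂ] F} (hA : A.IsClosed)
    (hd : Dense (A.domain : Set E)) : A.adjoint.adjoint = A :=
  LinearPMap.eq_of_mem_graph_iff fun x w => by
    rw [mem_graph_adjoint (adjoint_domain_dense hA hd)]
    refine ⟨mem_graph_of_adjoint hA hd, fun h y z hyz => ?_⟩
    have := (mem_graph_adjoint hd).1 hyz x w h
    rw [← inner_conj_symm, ← this, inner_conj_symm]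

/-- `R = (1 + ε A*A)⁻¹` and `Q = A R`. -/
structure IsResolvent (A : E →ₗ.[ℂ] F) (ε : ℝ) (R : E →L[ℂ] E) (Q : E →L[ℂ] F) : Prop where
  pos : 0 < ε
  mem : ∀ x, (R x, Q x) ∈ A.graph
  weak : ∀ x y z, (y, z) ∈ A.graph → inner ℂ y (x - R x) = ε * inner ℂ z (Q x)

theorem LinearPMap.IsClosed.exists_isResolvent {A : E →ₗ.[ℂ] F} (hA : A.IsClosed) {ε : ℝ}
    (hε : 0 < ε) : ∃ R Q, IsResolvent A ε R Q := by
  obtain ⟨P, hP⟩ := hA.exists_projection hε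
  refine ⟨ContinuousLinearMap.fst ℂ E F ∘L P ∘L ContinuousLinearMap.inl ℂ E F,
    ContinuousLinearMap.snd ℂ E F ∘L P ∘L ContinuousLinearMap.inl ℂ E F, hε,
    fun x => (hP (x, 0)).1, fun x y z h => ?_⟩
  have := (hP (x, 0)).2 _ h
  simp only [zero_sub, inner_neg_right] at this
  simp only [ContinuousLinearMap.comp_apply, ContinuousLinearMap.inl_apply,
    ContinuousLinearMap.coe_fst', ContinuousLinearMap.coe_snd']
  linear_combination this

namespace IsResolvent

variable {A : E →ₗ.[ℂ] F} {ε : ℝ} {R : E →L[ℂ] E} {Q : E →L[ℂ] F}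

/-- The difference of two solutions of the weak equation is an admissible test vector; testing with
it makes a sum of squares vanish. -/
theorem unique (h : IsResolvent A ε R Q) {x y : E} {z : F} (hyz : (y, z) ∈ A.graph)
    (hw : ∀ y' z', (y', z') ∈ A.graph → inner ℂ y' (x - y) = ε * inner ℂ z' z) :
    y = R x ∧ z = Q x := by
  have hd : (y - R x, z - Q x) ∈ A.graph := A.graph.sub_mem hyz (h.mem x)
  have h1 := hw _ _ hd
  have h2 := h.weak x _ _ hd
  have h3 : inner ℂ (y - R x) (y - R x) + ε * inner ℂ (z - Q x) (z - Q x) = (0 : ℂ) := by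
    have e1 : inner ℂ (y - R x) (y - R x) =
        inner ℂ (y - R x) (x - R x) - inner ℂ (y - R x) (x - y) := by
      rw [← inner_sub_right]; congr 1; abel
    have e2 : inner ℂ (z - Q x) (z - Q x) = inner ℂ (z - Q x) z - inner ℂ (z - Q x) (Q x) :=
      inner_sub_right _ _ _
    rw [e1, e2]
    linear_combination h2 - h1
  have h5 : ‖y - R x‖ ^ 2 + ε * ‖z - Q x‖ ^ 2 = 0 := by
    rw [inner_self_eq_ofReal_norm_sq, inner_self_eq_ofReal_norm_sq] at h3
    exact_mod_cast h3
  have hε := h.pos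
  have p1 := sq_nonneg ‖y - R x‖
  have p2 := mul_nonneg hε.le (sq_nonneg ‖z - Q x‖)
  have h6 : ‖y - R x‖ ^ 2 = 0 := by linarith
  have h7 : ε * ‖z - Q x‖ ^ 2 = 0 := by linarith
  have h8 : ‖z - Q x‖ ^ 2 = 0 := (mul_eq_zero.1 h7).resolve_left hε.ne'
  exact ⟨by simpa [sub_eq_zero] using h6, by simpa [sub_eq_zero] using h8⟩

/-- Testing with `x - R x` gives `ε Re⟨w - Q x, Q x⟩`, and `‖w‖‖Q x‖ - ‖Q x‖² ≤ ‖w‖²`. -/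
theorem norm_sq_le (h : IsResolvent A ε R Q) {x : E} {w : F} (hx : (x, w) ∈ A.graph) :
    ‖x - R x‖ ^ 2 ≤ ε * ‖w‖ ^ 2 := by
  have h1 := congrArg Complex.re (h.weak x _ _ (A.graph.sub_mem hx (h.mem x)))
  simp only at h1
  rw [inner_self_eq_ofReal_norm_sq, Complex.re_ofReal_mul, inner_sub_left,
    inner_self_eq_ofReal_norm_sq, Complex.ofReal_re, Complex.sub_re, Complex.ofReal_re] at h1
  have h2 : (inner ℂ w (Q x)).re ≤ ‖w‖ * ‖Q x‖ := re_inner_le_norm (𝕜 := ℂ) w (Q x)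
  rw [h1]
  refine mul_le_mul_of_nonneg_left ?_ h.pos.le
  nlinarith [sq_nonneg (‖w‖ - ‖Q x‖), sq_nonneg ‖w‖, norm_nonneg w, norm_nonneg (Q x)]

theorem norm_le (h : IsResolvent A ε R Q) (x : E) : ‖R x‖ ≤ ‖x‖ := by
  have h1 := congrArg Complex.re (h.weak x _ _ (h.mem x))
  rw [Complex.re_ofReal_mul, inner_sub_right, inner_self_eq_ofReal_norm_sq,
    inner_self_eq_ofReal_norm_sq, Complex.sub_re, Complex.ofReal_re, Complex.ofReal_re] at h1
  have h2 : (inner ℂ (R x) x).re ≤ ‖R x‖ * ‖x‖ := re_inner_le_norm (𝕜 := ℂ) (R x) x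
  have h4 : 0 ≤ ε * ‖Q x‖ ^ 2 := mul_nonneg h.pos.le (sq_nonneg _)
  by_contra hlt
  push Not at hlt
  nlinarith [norm_nonneg x, norm_nonneg (R x)]

theorem mem_adjoint (h : IsResolvent A ε R Q) (hd : Dense (A.domain : Set E)) (x : E) :
    (Q x, (ε : ℂ)⁻¹ • (x - R x)) ∈ A.adjoint.graph := by
  have hε : (ε : ℂ) ≠ 0 := by exact_mod_cast h.pos.ne'
  rw [mem_graph_adjoint hd]
  intro y z hyz
  rw [inner_smul_right, h.weak x y z hyz, ← mul_assoc, inv_mul_cancel₀ hε, one_mul]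

/-- The commutation `A (1 + ε A*A)⁻¹ = (1 + ε AA*)⁻¹ A` on `Dom A`. It reduces convergence of `A Rₙ
x` to strong convergence of the resolvents of `A*`. -/
theorem apply_eq (h : IsResolvent A ε R Q) (hd : Dense (A.domain : Set E))
    {R' : F →L[ℂ] F} {Q' : F →L[ℂ] E} (h' : IsResolvent A.adjoint ε R' Q')
    {x : E} {w : F} (hx : (x, w) ∈ A.graph) : Q x = R' w := by
  have hε : (ε : ℂ) ≠ 0 := by exact_mod_cast h.pos.ne'
  refine (h'.unique (h.mem_adjoint hd x) fun y z hyz => ?_).1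
  rw [inner_smul_right, ← mul_assoc, mul_inv_cancel₀ hε, one_mul]
  have := (mem_graph_adjoint hd).1 hyz _ _ (A.graph.sub_mem hx (h.mem x))
  simp only at this
  rw [← inner_conj_symm, this, inner_conj_symm]

end IsResolvent

/-- On the domain the error is at most `√ε ‖A y‖`; the resolvents are contractions and the domain is
dense. -/
theorem tendsto_resolvent {A : E →ₗ.[ℂ] F} (hd : Dense (A.domain : Set E)) {ε : ℕ → ℝ}
    (hε : Tendsto ε atTop (𝓝 0)) {R : ℕ → E →L[ℂ] E} {Q : ℕ → E →L[ℂ] F}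
    (h : ∀ n, IsResolvent A (ε n) (R n) (Q n)) (x : E) :
    Tendsto (fun n => R n x) atTop (𝓝 x) := by
  rw [Metric.tendsto_atTop]
  intro η hη
  obtain ⟨y, hy, hxy⟩ := Metric.mem_closure_iff.1 (hd x) (η / 3) (by positivity)
  have hlim : Tendsto (fun n => ε n * ‖A ⟨y, hy⟩‖ ^ 2) atTop (𝓝 0) := by
    simpa using hε.mul_const (‖A ⟨y, hy⟩‖ ^ 2)
  obtain ⟨N, hN⟩ := eventually_atTop.1 (hlim.eventually
    (gt_mem_nhds (show (0 : ℝ) < (η / 3) ^ 2 by positivity)))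
  refine ⟨N, fun n hn => ?_⟩
  have h1 : ‖y - R n y‖ < η / 3 := by
    refine lt_of_pow_lt_pow_left₀ 2 (by positivity) ?_
    exact ((h n).norm_sq_le (LinearPMap.mem_graph_mk hy)).trans_lt (hN n hn)
  have h2 : ‖R n (y - x)‖ ≤ ‖y - x‖ := (h n).norm_le _
  rw [dist_eq_norm] at hxy ⊢
  have e : R n x - x = -(R n (y - x)) - (y - R n y) - (x - y) := by rw [map_sub]; abel
  rw [e]
  have h3 := norm_sub_le (-(R n (y - x)) - (y - R n y)) (x - y)
  have h4 := norm_sub_le (-(R n (y - x))) (y - R n y)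
  rw [norm_neg] at h4
  rw [norm_sub_rev y x] at h2
  linarith

/-- Resolvents of a closed densely defined operator for `ε → 0`, with `A Rₙ → A` on the domain. -/
theorem exists_resolvent_seq {A : E →ₗ.[ℂ] F} (hA : A.IsClosed) (hd : Dense (A.domain : Set E)) :
    ∃ (ε : ℕ → ℝ) (R : ℕ → E →L[ℂ] E) (Q : ℕ → E →L[ℂ] F),
      (∀ n, IsResolvent A (ε n) (R n) (Q n)) ∧ (∀ x, Tendsto (fun n => R n x) atTop (𝓝 x)) ∧
      ∀ x w, (x, w) ∈ A.graph → Tendsto (fun n => Q n x) atTop (𝓝 w) := by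
  have hε : ∀ n : ℕ, 0 < (1 : ℝ) / (n + 1) := fun n => Nat.one_div_pos_of_nat
  choose R Q h using fun n : ℕ => hA.exists_isResolvent (hε n)
  choose R' Q' h' using fun n : ℕ =>
    (LinearPMap.adjoint_isClosed hd).exists_isResolvent (hε n)
  refine ⟨_, R, Q, h, tendsto_resolvent hd tendsto_one_div_add_atTop_nhds_zero_nat h,
    fun x w hx => ?_⟩
  have := tendsto_resolvent (adjoint_domain_dense hA hd) tendsto_one_div_add_atTop_nhds_zero_nat
    h' w
  exact this.congr fun n => ((h n).apply_eq hd (h' n) hx).symm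

end GraphCalculus

/-! ### Uniqueness and commutation for unbounded positive square roots. -/

section PositiveSqrt

variable {K : Type*} [NormedAddCommGroup K] [InnerProductSpace ℂ K] [CompleteSpace K]
variable {P S : K →ₗ.[ℂ] K} {ε : ℝ} {R Q : K →L[ℂ] K}

theorem IsSelfAdjoint.mem_graph_iff (hS : IsSelfAdjoint S) {y z : K} :
    (y, z) ∈ S.graph ↔ ∀ x w, (x, w) ∈ S.graph → inner ℂ w y = inner ℂ x z := by
  conv_lhs => rw [← LinearPMap.isSelfAdjoint_def.1 hS]
  exact mem_graph_adjoint hS.dense_domain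

theorem IsPosSelfAdjoint.re_inner_nonneg (hS : IsPosSelfAdjoint S) {x y : K}
    (h : (x, y) ∈ S.graph) : 0 ≤ (inner ℂ x y).re := by
  obtain ⟨hx, rfl⟩ := LinearPMap.mem_graph_pair.1 h
  exact hS.2 ⟨x, hx⟩

theorem IsSelfAdjoint.im_inner_eq_zero (hS : IsSelfAdjoint S) {x y : K}
    (h : (x, y) ∈ S.graph) : (inner ℂ x y).im = 0 := by
  have h1 := hS.mem_graph_iff.1 h _ _ h
  rw [← inner_conj_symm] at h1
  exact Complex.conj_eq_iff_im.1 h1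

namespace IsResolvent

theorem mem_of_isSelfAdjoint (h : IsResolvent S ε R Q) (hS : IsSelfAdjoint S) (x : K) :
    (Q x, (ε : ℂ)⁻¹ • (x - R x)) ∈ S.graph := by
  have := h.mem_adjoint hS.dense_domain x
  rwa [LinearPMap.isSelfAdjoint_def.1 hS] at this

theorem apply_eq_of_isSelfAdjoint (h : IsResolvent S ε R Q) (hS : IsSelfAdjoint S) {x w : K}
    (hx : (x, w) ∈ S.graph) : Q x = R w :=
  h.apply_eq hS.dense_domain (by rwa [LinearPMap.isSelfAdjoint_def.1 hS]) hx

theorem mul_self (h : IsResolvent S ε R Q) (hS : IsSelfAdjoint S) :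
    Q * Q = (ε : ℂ)⁻¹ • (R - R * R) := by
  ext x
  have h1 : Q (R x) = R (Q x) := h.apply_eq_of_isSelfAdjoint hS (h.mem x)
  have h2 := h.mem_of_isSelfAdjoint hS (R x)
  rw [h1] at h2
  exact S.graph_functional (h.mem (Q x)) h2

theorem isPositive (h : IsResolvent S ε R Q) (hS : IsPosSelfAdjoint S) : Q.IsPositive := by
  rw [ContinuousLinearMap.isPositive_iff_complex]
  intro x
  have hε := h.pos
  have hm := h.mem_of_isSelfAdjoint hS.1 x
  -- Since `x = R x + ε S Q x` and `Q x = S R x`, both summands are values of the form of `S`.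
  have e : inner ℂ (Q x) x = (ε : ℂ) * inner ℂ (Q x) ((ε : ℂ)⁻¹ • (x - R x)) +
      starRingEnd ℂ (inner ℂ (R x) (Q x)) := by
    have hε' : (ε : ℂ) ≠ 0 := by exact_mod_cast h.pos.ne'
    rw [inner_smul_right, ← mul_assoc, mul_inv_cancel₀ hε', one_mul, inner_conj_symm,
      ← inner_add_right, sub_add_cancel]
  have i1 := hS.1.im_inner_eq_zero hm
  have i2 := hS.1.im_inner_eq_zero (h.mem x)
  have r1 := hS.re_inner_nonneg hm
  have r2 := hS.re_inner_nonneg (h.mem x)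
  have hre : (inner ℂ (Q x) x).re = ε * (inner ℂ (Q x) ((ε : ℂ)⁻¹ • (x - R x))).re +
      (inner ℂ (R x) (Q x)).re := by
    rw [e, Complex.add_re, Complex.re_ofReal_mul, Complex.conj_re]
  have him : (inner ℂ (Q x) x).im = 0 := by
    rw [e, Complex.add_im, Complex.im_ofReal_mul, Complex.conj_im, i1, i2]
    simp
  refine ⟨?_, ?_⟩
  · exact Complex.ext rfl him.symm
  · change 0 ≤ (inner ℂ (Q x) x).re
    rw [hre]
    positivity

/-- Together with `apply_eq_of_mem_opComp`, by which `R` depends on `S²` alone, this recovers `S R`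
from `S²` by the bounded functional calculus. -/
theorem eq_sqrt (h : IsResolvent S ε R Q) (hS : IsPosSelfAdjoint S) :
    CFC.sqrt ((ε : ℂ)⁻¹ • (R - R * R)) = Q :=
  CFC.sqrt_unique (h.mul_self hS.1)
    ((ContinuousLinearMap.nonneg_iff_isPositive Q).2 (h.isPositive hS))

theorem apply_eq_of_mem_opComp (h : IsResolvent S ε R Q) (hS : IsSelfAdjoint S) {x y : K}
    (hy : (y, (ε : ℂ)⁻¹ • (x - y)) ∈ (opComp S S).graph) : y = R x := by
  obtain ⟨w, h1, h2⟩ := mem_graph_opComp.1 hy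
  refine (h.unique h1 fun y' z' h' => ?_).1
  have hε : (ε : ℂ) ≠ 0 := by exact_mod_cast h.pos.ne'
  rw [hS.mem_graph_iff.1 h2 _ _ h', inner_smul_right, ← mul_assoc, mul_inv_cancel₀ hε, one_mul]

theorem mem_opComp (h : IsResolvent S ε R Q) (hS : IsSelfAdjoint S) (x : K) :
    (R x, (ε : ℂ)⁻¹ • (x - R x)) ∈ (opComp S S).graph :=
  mem_graph_opComp.2 ⟨_, h.mem x, h.mem_of_isSelfAdjoint hS x⟩

/-- An operator commuting with `S²` commutes with the resolvent and with `S R`. -/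
theorem commute (h : IsResolvent S ε R Q) (hS : IsPosSelfAdjoint S) {B : K →L[ℂ] K}
    (hB : ∀ x y, (x, y) ∈ (opComp S S).graph → (B x, B y) ∈ (opComp S S).graph) :
    Commute R B ∧ Commute Q B := by
  have hR : Commute R B := by
    ext x
    have := hB _ _ (h.mem_opComp hS.1 x)
    rw [map_smul, map_sub] at this
    exact (h.apply_eq_of_mem_opComp hS.1 this).symm
  refine ⟨hR, ?_⟩
  rw [← h.eq_sqrt hS]
  exact Commute.cfcₙ_nnreal ((hR.sub_left (hR.mul_left hR)).smul_left _) _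

end IsResolvent

/-- The pairs `(R x, Q x)` are dense in the graph of `S`, so statements on `S` reduce to bounded
operators. -/
theorem IsPosSelfAdjoint.mem_graph_of_forall_resolvent (hS : IsPosSelfAdjoint S)
    {T : K →ₗ.[ℂ] K} (hT : T.IsClosed) {B : K →L[ℂ] K}
    (h : ∀ ε R Q, IsResolvent S ε R Q → ∀ x, (B (R x), B (Q x)) ∈ T.graph) {x y : K}
    (hxy : (x, y) ∈ S.graph) : (B x, B y) ∈ T.graph := by
  obtain ⟨ε, R, Q, hr, hR, hQ⟩ := exists_resolvent_seq hS.1.isClosed hS.1.dense_domain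
  exact hT.mem_of_tendsto ((B.continuous.tendsto x).comp (hR x))
    ((B.continuous.tendsto y).comp (hQ x y hxy)) fun n => h _ _ _ (hr n) x

theorem IsOpSqrt.unique {S' : K →ₗ.[ℂ] K} (h : IsOpSqrt P S) (h' : IsOpSqrt P S') : S = S' := by
  have key : ∀ S S' : K →ₗ.[ℂ] K, IsOpSqrt P S → IsOpSqrt P S' → S.graph ≤ S'.graph := by
    rintro S S' h h' ⟨x, y⟩ hxy
    refine h.1.mem_graph_of_forall_resolvent (B := 1) h'.1.1.isClosed (fun ε R Q hr x => ?_) hxy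
    obtain ⟨R', Q', hr'⟩ := h'.1.1.isClosed.exists_isResolvent hr.pos
    have hR : R = R' := by
      ext x
      refine hr'.apply_eq_of_mem_opComp h'.1.1 ?_
      rw [h'.2, ← h.2]
      exact hr.mem_opComp h.1.1 x
    have hQ : Q = Q' := by rw [← hr.eq_sqrt h.1, ← hr'.eq_sqrt h'.1, hR]
    rw [hR, hQ]
    exact hr'.mem x
  exact LinearPMap.eq_of_eq_graph (le_antisymm (key _ _ h h') (key _ _ h' h))

theorem IsOpSqrt.commutes (h : IsOpSqrt P S) {B : K →L[ℂ] K}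
    (hB : ∀ x y, (x, y) ∈ P.graph → (B x, B y) ∈ P.graph) {x y : K} (hxy : (x, y) ∈ S.graph) :
    (B x, B y) ∈ S.graph := by
  refine h.1.mem_graph_of_forall_resolvent h.1.1.isClosed (fun ε R Q hr x => ?_) hxy
  obtain ⟨h1, h2⟩ := hr.commute h.1 (B := B) (by rwa [h.2])
  have e1 : B (R x) = R (B x) := (congrArg (fun T : K →L[ℂ] K => T x) h1.eq).symm
  have e2 : B (Q x) = Q (B x) := (congrArg (fun T : K →L[ℂ] K => T x) h2.eq).symm
  rw [e1, e2]
  exact hr.mem _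

end PositiveSqrt

/-! ### Absolute values and contractions defined by linear relations. -/

section Polar

variable {E F G : Type*} [NormedAddCommGroup E] [InnerProductSpace ℂ E] [CompleteSpace E]
  [NormedAddCommGroup F] [InnerProductSpace ℂ F] [CompleteSpace F]
  [NormedAddCommGroup G] [InnerProductSpace ℂ G] [CompleteSpace G]

/-- The absolute value of a bounded operator. -/
theorem exists_abs (k : E →L[ℂ] F) : ∃ q : E →L[ℂ] E, q.adjoint = q ∧ (∀ x, ‖q x‖ = ‖k x‖) ∧
    ∀ b : E →L[ℂ] E, Commute (k.adjoint ∘L k) b → Commute q b := by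
  have hpos : 0 ≤ k.adjoint ∘L k :=
    (ContinuousLinearMap.nonneg_iff_isPositive _).2
      (ContinuousLinearMap.isPositive_adjoint_comp_self k)
  set q := CFC.sqrt (k.adjoint ∘L k) with hq
  have hqsa : q.adjoint = q :=
    ((ContinuousLinearMap.nonneg_iff_isPositive q).1 (CFC.sqrt_nonneg _)).isSelfAdjoint
  have hqq : q * q = k.adjoint ∘L k := CFC.sqrt_mul_sqrt_self _ hpos
  refine ⟨q, hqsa, fun x => ?_, fun b hb => Commute.cfcₙ_nnreal hb NNReal.sqrt⟩
  have h1 : inner ℂ (q x) (q x) = inner ℂ (k x) (k x) := by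
    rw [← ContinuousLinearMap.adjoint_inner_right, hqsa,
      ← ContinuousLinearMap.adjoint_inner_right]
    exact congrArg (fun T : E →L[ℂ] E => inner ℂ x (T x)) hqq
  rw [inner_self_eq_ofReal_norm_sq, inner_self_eq_ofReal_norm_sq] at h1
  have h2 : ‖q x‖ ^ 2 = ‖k x‖ ^ 2 := by exact_mod_cast h1
  exact (pow_left_inj₀ (norm_nonneg _) (norm_nonneg _) two_ne_zero).1 h2

/-- On `Dom(A*A)` both squared norms equal `⟨x, A*A x⟩`. -/
theorem norm_eq_of_mem_adjoint_comp {A : E →ₗ.[ℂ] F} (hd : Dense (A.domain : Set E))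
    {B : E →ₗ.[ℂ] G} (hd' : Dense (B.domain : Set E))
    (h : opComp A.adjoint A = opComp B.adjoint B) {x z : E} {y : F}
    (hxy : (x, y) ∈ A.graph) (hyz : (y, z) ∈ A.adjoint.graph) :
    ∃ w, (x, w) ∈ B.graph ∧ ‖w‖ = ‖y‖ := by
  have hm : (x, z) ∈ (opComp B.adjoint B).graph := h ▸ mem_graph_opComp.2 ⟨y, hxy, hyz⟩
  obtain ⟨w, hw, hwz⟩ := mem_graph_opComp.1 hm
  refine ⟨w, hw, ?_⟩
  have h1 := (mem_graph_adjoint hd).1 hyz _ _ hxy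
  have h2 := (mem_graph_adjoint hd').1 hwz _ _ hw
  rw [← h1, inner_self_eq_ofReal_norm_sq, inner_self_eq_ofReal_norm_sq] at h2
  have h3 : ‖w‖ ^ 2 = ‖y‖ ^ 2 := by exact_mod_cast h2
  exact (pow_left_inj₀ (norm_nonneg _) (norm_nonneg _) two_ne_zero).1 h3

/-- If `A*A = B*B`, then `‖A x‖ = ‖B x‖` on the common domain of `A` and `B`. -/
theorem exists_norm_eq_of_adjoint_comp_eq {A : E →ₗ.[ℂ] F} (hA : A.IsClosed)
    (hd : Dense (A.domain : Set E)) {B : E →ₗ.[ℂ] G} (hB : B.IsClosed)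
    (hd' : Dense (B.domain : Set E)) (h : opComp A.adjoint A = opComp B.adjoint B) {x : E} {y : F}
    (hxy : (x, y) ∈ A.graph) : ∃ w, (x, w) ∈ B.graph ∧ ‖w‖ = ‖y‖ := by
  obtain ⟨ε, R, Q, hr, hR, hQ⟩ := exists_resolvent_seq hA hd
  have hadj : ∀ n, (Q n x, ((ε n : ℂ))⁻¹ • (x - R n x)) ∈ A.adjoint.graph :=
    fun n => (hr n).mem_adjoint hd x
  choose w hw hn using fun n => norm_eq_of_mem_adjoint_comp hd hd' h ((hr n).mem x) (hadj n)
  -- The norm identity also holds for the differences `Rₙ x - Rₘ x`, so `B Rₙ x` is Cauchy along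
  -- with `A Rₙ x`.
  have hdist : ∀ n m, dist (w n) (w m) = dist (Q n x) (Q m x) := fun n m => by
    obtain ⟨v, hv, hvn⟩ := norm_eq_of_mem_adjoint_comp hd hd' h
      (A.graph.sub_mem ((hr n).mem x) ((hr m).mem x))
      (A.adjoint.graph.sub_mem (hadj n) (hadj m))
    rw [dist_eq_norm, dist_eq_norm, ← hvn]
    congr 1
    exact B.graph_functional (B.graph.sub_mem (hw n) (hw m)) hv
  have hc : CauchySeq w := by
    have := (hQ x y hxy).cauchySeq
    rw [Metric.cauchySeq_iff] at this ⊢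
    simpa only [hdist] using this
  obtain ⟨l, hl⟩ := cauchySeq_tendsto_of_complete hc
  refine ⟨l, hB.mem_of_tendsto (hR x) hl hw, ?_⟩
  have h1 := hl.norm
  simp only [hn] at h1
  exact tendsto_nhds_unique h1 (hQ x y hxy).norm

/-- A contractive linear relation `D` is contained in the graph of a contraction `V`, which can be
chosen to vanish on the orthogonal complement of the domain of `D`; `V` intertwines `a` and `b` if
`D` is invariant under `a × b` and its domain under `a*`. -/
theorem exists_contraction_of_relation (D : Submodule ℂ (E × F))
    (hD : ∀ p ∈ D, ‖p.2‖ ≤ ‖p.1‖) :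
    ∃ V : E →L[ℂ] F, (∀ p ∈ D, V p.1 = p.2) ∧ (∀ x, ‖V x‖ ≤ ‖x‖) ∧
      ∀ (a : E →L[ℂ] E) (b : F →L[ℂ] F), (∀ p ∈ D, (a p.1, b p.2) ∈ D) →
        (∀ p ∈ D, ∃ y, (a.adjoint p.1, y) ∈ D) → ∀ x, V (a x) = b (V x) := by
  let M₀ : Submodule ℂ E := D.map (LinearMap.fst ℂ E F)
  let M := M₀.topologicalClosure
  have hM₀ : ∀ p ∈ D, p.1 ∈ M₀ := fun p hp => ⟨p, hp, rfl⟩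
  have hM : ∀ p ∈ D, p.1 ∈ M := fun p hp => M₀.le_topologicalClosure (hM₀ p hp)
  have : CompleteSpace M := M₀.isClosed_topologicalClosure.completeSpace_coe
  let X : D →ₗ[ℂ] M := (LinearMap.fst ℂ E F ∘ₗ D.subtype).codRestrict M fun p => hM _ p.2
  let Z : D →ₗ[ℂ] F := LinearMap.snd ℂ E F ∘ₗ D.subtype
  have hX : DenseRange X := by
    intro m
    rw [mem_closure_iff_seq_limit]
    obtain ⟨u, hu, hlim⟩ := mem_closure_iff_seq_limit.1
      (show (m : E) ∈ closure (M₀ : Set E) from m.2)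
    choose p hp hpu using hu
    refine ⟨fun n => X ⟨p n, hp n⟩, fun n => ⟨_, rfl⟩, ?_⟩
    rw [tendsto_subtype_rng]
    exact hlim.congr fun n => (hpu n).symm
  have hn : ∀ p : D, ‖Z p‖ ≤ 1 * ‖X p‖ := fun p => by
    rw [one_mul]
    exact hD _ p.2
  let V := (Z.extendOfNorm X) ∘L M.orthogonalProjectionOnto
  have hV : ∀ p ∈ D, V p.1 = p.2 := fun p hp => by
    have e : M.orthogonalProjectionOnto p.1 = X ⟨p, hp⟩ :=
      M.orthogonalProjectionOnto_mem_subspace_eq_self (X ⟨p, hp⟩)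
    change Z.extendOfNorm X (M.orthogonalProjectionOnto p.1) = p.2
    rw [e, LinearMap.extendOfNorm_eq hX ⟨1, hn⟩]
    rfl
  refine ⟨V, hV, fun x => ?_, fun a b h1 h2 x => ?_⟩
  · refine (LinearMap.norm_extendOfNorm_apply_le hX 1 hn _).trans ?_
    rw [one_mul]
    exact M.norm_orthogonalProjectionOnto_apply_le x
  · have hVM : ∀ y ∈ M, V (a y) = b (V y) := by
      refine fun y hy => closure_minimal (s := (M₀ : Set E)) (t := {y | V (a y) = b (V y)}) ?_
        (isClosed_eq (V.continuous.comp a.continuous) (b.continuous.comp V.continuous)) hy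
      rintro _ ⟨p, hp, rfl⟩
      exact (hV _ (h1 p hp)).trans (congrArg b (hV p hp).symm)
    have hV0 : ∀ y ∈ Mᗮ, V y = 0 := fun y hy => by
      change Z.extendOfNorm X (M.orthogonalProjectionOnto y) = 0
      rw [M.orthogonalProjectionOnto_apply_of_mem_orthogonal hy, map_zero]
    have ha : ∀ y ∈ Mᗮ, a y ∈ Mᗮ := fun y hy => by
      rw [Submodule.orthogonal_closure] at hy ⊢
      rw [Submodule.mem_orthogonal] at hy ⊢
      rintro _ ⟨p, hp, rfl⟩
      obtain ⟨z, hz⟩ := h2 p hp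
      have := hy _ (hM₀ _ hz)
      rwa [ContinuousLinearMap.adjoint_inner_left] at this
    have e : x = M.starProjection x + (x - M.starProjection x) := by abel
    have m1 := M.starProjection_apply_mem x
    have m2 := M.sub_starProjection_mem_orthogonal x
    rw [e, map_add, map_add, map_add, map_add, hVM _ m1, hV0 _ m2, hV0 _ (ha _ m2), map_zero]

end Polar

theorem prodMap_mem_span {ι X Y : Type*} [NormedAddCommGroup X] [NormedSpace ℂ X]
    [NormedAddCommGroup Y] [NormedSpace ℂ Y] {a : X →L[ℂ] X} {b : Y →L[ℂ] Y} {u : ι → X} {v : ι → Y}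
    (h : ∀ i, ∃ k, a (u i) = u k ∧ b (v i) = v k) {p : X × Y}
    (hp : p ∈ Submodule.span ℂ (Set.range fun i => (u i, v i))) :
    (a p.1, b p.2) ∈ Submodule.span ℂ (Set.range fun i => (u i, v i)) := by
  induction hp using Submodule.span_induction with
  | mem p hp =>
    obtain ⟨i, rfl⟩ := hp
    obtain ⟨k, h1, h2⟩ := h i
    exact Submodule.subset_span ⟨k, Prod.ext h1.symm h2.symm⟩
  | zero =>
    convert Submodule.zero_mem _ using 1
    exact Prod.ext (map_zero a) (map_zero b)
  | add p q _ _ hp hq =>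
    convert Submodule.add_mem _ hp hq using 1
    exact Prod.ext (map_add a _ _) (map_add b _ _)
  | smul c p _ hp =>
    convert Submodule.smul_mem _ c hp using 1
    exact Prod.ext (map_smul a _ _) (map_smul b _ _)

/-! ### The regular representations, and finiteness of the commutant of `λ`. -/

section RegularRepresentation

variable {Γ : Type*} [Group Γ]

theorem leftReg_apply (γ x : Γ) (u : EllTwo Γ) : leftReg γ u x = u (γ⁻¹ * x) := rfl

theorem rightReg_apply (γ x : Γ) (u : EllTwo Γ) : rightReg γ u x = u (x * γ) := rfl

theorem leftReg_one (u : EllTwo Γ) : leftReg (1 : Γ) u = u := by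
  ext x
  rw [leftReg_apply, inv_one, one_mul]

theorem leftReg_leftReg (a b : Γ) (u : EllTwo Γ) : leftReg a (leftReg b u) = leftReg (a * b) u := by
  ext x
  simp only [leftReg_apply, mul_inv_rev, mul_assoc]

theorem rightReg_leftReg (a b : Γ) (u : EllTwo Γ) :
    rightReg a (leftReg b u) = leftReg b (rightReg a u) := by
  ext x
  simp only [leftReg_apply, rightReg_apply, mul_assoc]

theorem rightReg_rightReg (a b : Γ) (u : EllTwo Γ) :
    rightReg a (rightReg b u) = rightReg (a * b) u := by
  ext x
  simp only [rightReg_apply, mul_assoc]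

theorem rightReg_one (u : EllTwo Γ) : rightReg (1 : Γ) u = u := by
  ext x
  rw [rightReg_apply, mul_one]

theorem norm_permOp {ι : Type*} (e : Equiv.Perm ι) (u : EllTwo ι) : ‖permOp e u‖ = ‖u‖ := by
  rw [lp.norm_eq_tsum_rpow (by norm_num), lp.norm_eq_tsum_rpow (by norm_num)]
  congr 1
  exact e.tsum_eq fun x => ‖u x‖ ^ (2 : ℝ≥0∞).toReal

theorem norm_rightReg (γ : Γ) (u : EllTwo Γ) : ‖rightReg γ u‖ = ‖u‖ := norm_permOp _ _

theorem inner_leftReg_left (γ : Γ) (u v : EllTwo Γ) :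
    inner ℂ (leftReg γ u) v = inner ℂ u (leftReg γ⁻¹ v) := by
  rw [lp.inner_eq_tsum, lp.inner_eq_tsum, ← (Equiv.mulLeft γ).tsum_eq]
  refine tsum_congr fun x => ?_
  simp only [leftReg_apply, Equiv.coe_mulLeft, inv_mul_cancel_left, inv_inv]

theorem leftReg_adjoint (γ : Γ) : (leftReg γ).adjoint = leftReg γ⁻¹ :=
  ((ContinuousLinearMap.eq_adjoint_iff _ _).2 fun u v => by
    rw [inner_leftReg_left, inv_inv]).symm

open Classical in
theorem deltaOne_apply (x : Γ) : deltaOne Γ x = if x = 1 then 1 else 0 := by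
  rw [deltaOne, lp.single_apply, Pi.single_apply]

theorem inner_deltaOne (u : EllTwo Γ) : inner ℂ (deltaOne Γ) u = u 1 := by
  classical
  rw [deltaOne, lp.inner_single_left]
  simp

theorem inner_leftReg_deltaOne (γ : Γ) (u : EllTwo Γ) :
    inner ℂ (leftReg γ (deltaOne Γ)) u = u γ := by
  rw [inner_leftReg_left, inner_deltaOne, leftReg_apply, inv_inv, mul_one]

theorem rightReg_deltaOne (γ : Γ) : rightReg γ (deltaOne Γ) = leftReg γ⁻¹ (deltaOne Γ) := by
  classical
  ext x
  rw [rightReg_apply, leftReg_apply, deltaOne_apply, deltaOne_apply, inv_inv]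
  exact if_congr (mul_eq_one_iff_eq_inv.trans mul_eq_one_iff_eq_inv'.symm) rfl rfl

variable (Γ) in
/-- The map from finitely supported functions to `ℓ²(Γ)`. -/
def deltaComb : (Γ →₀ ℂ) →ₗ[ℂ] EllTwo Γ :=
  Finsupp.linearCombination ℂ fun γ : Γ => leftReg γ (deltaOne Γ)

theorem eq_of_inner_leftReg_deltaOne {u v : EllTwo Γ}
    (h : ∀ γ, inner ℂ (leftReg γ (deltaOne Γ)) u = inner ℂ (leftReg γ (deltaOne Γ)) v) : u = v := by
  ext γ
  rw [← inner_leftReg_deltaOne, h, inner_leftReg_deltaOne]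

theorem dense_range_deltaComb : Dense (LinearMap.range (deltaComb Γ) : Set (EllTwo Γ)) := by
  rw [Submodule.dense_iff_topologicalClosure_eq_top, Submodule.topologicalClosure_eq_top_iff,
    Submodule.eq_bot_iff]
  intro v hv
  refine eq_of_inner_leftReg_deltaOne fun γ => ?_
  rw [inner_zero_right]
  refine (Submodule.mem_orthogonal _ _).1 hv _ ⟨Finsupp.single γ 1, ?_⟩
  rw [deltaComb, Finsupp.linearCombination_single, one_smul]

theorem eqOn_of_leftReg_deltaOne {X : Type*} [NormedAddCommGroup X] [NormedSpace ℂ X]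
    {A B : EllTwo Γ →L[ℂ] X}
    (h : ∀ γ, A (leftReg γ (deltaOne Γ)) = B (leftReg γ (deltaOne Γ))) : A = B := by
  ext x
  refine dense_range_deltaComb.induction (P := fun x => A x = B x) ?_
    (isClosed_eq A.continuous B.continuous) x
  rintro _ ⟨c, rfl⟩
  rw [deltaComb, Finsupp.linearCombination_apply, Finsupp.sum, map_sum, map_sum]
  exact Finset.sum_congr rfl fun γ _ => by rw [map_smul, map_smul, h]

/-- The involution `f*(γ) = conj f(γ⁻¹)` of `ℓ²(Γ)`. -/
def reflectConj (f : EllTwo Γ) : EllTwo Γ :=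
  star (permOp (Equiv.inv Γ) f)

theorem reflectConj_apply (f : EllTwo Γ) (γ : Γ) :
    reflectConj f γ = starRingEnd ℂ (f γ⁻¹) := rfl

theorem norm_reflectConj (f : EllTwo Γ) : ‖reflectConj f‖ = ‖f‖ := by
  rw [reflectConj, norm_star, norm_permOp]

/-- The bounded operators commuting with the left regular representation. -/
def CommLeft (T : EllTwo Γ →L[ℂ] EllTwo Γ) : Prop :=
  ∀ γ x, T (leftReg γ x) = leftReg γ (T x)

namespace CommLeft

variable {A B : EllTwo Γ →L[ℂ] EllTwo Γ}

theorem one : CommLeft (1 : EllTwo Γ →L[ℂ] EllTwo Γ) := fun _ _ => rfl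

theorem comp (hA : CommLeft A) (hB : CommLeft B) : CommLeft (A ∘L B) := fun γ x => by
  rw [ContinuousLinearMap.comp_apply, hB, hA, ContinuousLinearMap.comp_apply]

theorem adjoint (hA : CommLeft A) : CommLeft A.adjoint := fun γ x => by
  refine ext_inner_right ℂ fun y => ?_
  rw [ContinuousLinearMap.adjoint_inner_left, inner_leftReg_left, inner_leftReg_left,
    ContinuousLinearMap.adjoint_inner_left, hA]

theorem rightReg (γ : Γ) : CommLeft (rightReg γ) := fun _ _ => rightReg_leftReg _ _ _

theorem adjoint_deltaOne (hA : CommLeft A) :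
    A.adjoint (deltaOne Γ) = reflectConj (A (deltaOne Γ)) := by
  refine eq_of_inner_leftReg_deltaOne fun γ => ?_
  rw [ContinuousLinearMap.adjoint_inner_right, hA, inner_leftReg_deltaOne, reflectConj_apply,
    inner_leftReg_left, ← inner_leftReg_deltaOne, inner_conj_symm]

/-- The trace property `τ(AA*) = τ(A*A)`, the source of all finiteness arguments below. -/
theorem norm_adjoint_deltaOne (hA : CommLeft A) :
    ‖A.adjoint (deltaOne Γ)‖ = ‖A (deltaOne Γ)‖ := by
  rw [hA.adjoint_deltaOne, norm_reflectConj]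

/-- The commutant of the left regular representation is finite: its isometries are unitary. -/
theorem comp_adjoint_of_isometry (hA : CommLeft A) (h : A.adjoint ∘L A = 1) :
    A ∘L A.adjoint = 1 := by
  refine eqOn_of_leftReg_deltaOne fun γ => ?_
  rw [(hA.comp hA.adjoint) γ, one_apply_eq_self]
  congr 1
  have hn : ∀ x, A.adjoint (A x) = x := fun x => congrArg (fun T : EllTwo Γ →L[ℂ] EllTwo Γ => T x) h
  have h1 : inner ℂ (A (deltaOne Γ)) (A (deltaOne Γ)) = inner ℂ (deltaOne Γ) (deltaOne Γ) := by
    rw [← ContinuousLinearMap.adjoint_inner_left, hn]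
  have h2 : inner ℂ (A.adjoint (deltaOne Γ)) (A.adjoint (deltaOne Γ)) =
      inner ℂ (deltaOne Γ) (deltaOne Γ) := by
    rw [← h1, inner_self_eq_ofReal_norm_sq, inner_self_eq_ofReal_norm_sq, hA.norm_adjoint_deltaOne]
  -- With `y = A* δ_e`, `‖A y - δ_e‖² = ‖δ_e‖² - ‖y‖²`, which vanishes because `‖y‖ = ‖A δ_e‖ =
  -- ‖δ_e‖`.
  set y := A.adjoint (deltaOne Γ) with hy
  rw [ContinuousLinearMap.comp_apply, ← sub_eq_zero, ← inner_self_eq_zero (𝕜 := ℂ)]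
  have e1 : inner ℂ (A y) (deltaOne Γ) = inner ℂ y y := by
    rw [hy, ContinuousLinearMap.adjoint_inner_right]
  have e2 : inner ℂ (deltaOne Γ) (A y) = inner ℂ y y := by
    rw [hy, ← ContinuousLinearMap.adjoint_inner_left]
  have e3 : inner ℂ (A y) (A y) = inner ℂ y y := by
    rw [← ContinuousLinearMap.adjoint_inner_left, hn]
  rw [← hy, inner_sub_left, inner_sub_right, inner_sub_right, e1, e2, e3, h2]
  ring

end CommLeft

/-! ### Maximality of closed operators commuting with the left regular representation -/

section Maximality

variable {M : Type*} [NormedAddCommGroup M] [InnerProductSpace ℂ M] [CompleteSpace M]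

/-- `W` is the polar part of `k = p j*`, where `p` projects onto `E`. Density of `j(E)` makes `k`
injective and injectivity of `j` on `E` makes its range dense in `E`, so `W` identifies `ℓ²(Γ)` with
`E` equivariantly. -/
theorem exists_isometry_of_invariant {u : Γ → M →L[ℂ] M}
    (hu : ∀ γ x y, inner ℂ (u γ x) y = inner ℂ x (u γ⁻¹ y)) {j : M →L[ℂ] EllTwo Γ}
    (hj : ∀ γ x, j (u γ x) = leftReg γ (j x)) {E : Submodule ℂ M} (hE : IsClosed (E : Set M))
    (hEu : ∀ γ, ∀ x ∈ E, u γ x ∈ E) (hinj : ∀ x ∈ E, j x = 0 → x = 0)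
    (hd : Dense (E.map (j : M →ₗ[ℂ] EllTwo Γ) : Set (EllTwo Γ))) :
    ∃ W : EllTwo Γ →L[ℂ] M, W.adjoint ∘L W = 1 ∧ (∀ x, W x ∈ E) ∧
      (∀ x ∈ E, W (W.adjoint x) = x) ∧ ∀ γ x, W (leftReg γ x) = u γ (W x) := by
  have : CompleteSpace E := hE.completeSpace_coe
  set p := E.starProjection with hp
  have hpu : ∀ γ x, p (u γ x) = u γ (p x) := fun γ x => by
    refine Submodule.eq_starProjection_of_mem_orthogonal
      (hEu γ _ (E.starProjection_apply_mem x)) ?_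
    rw [← map_sub, Submodule.mem_orthogonal']
    intro y hy
    rw [hu]
    exact (Submodule.mem_orthogonal' _ _).1 (E.sub_starProjection_mem_orthogonal x) _ (hEu _ _ hy)
  have hpi : ∀ x y, inner ℂ (p x) y = inner ℂ x (p y) := E.inner_starProjection_left_eq_right
  have hju : ∀ γ x, j.adjoint (leftReg γ x) = u γ (j.adjoint x) := fun γ x => by
    refine ext_inner_right ℂ fun y => ?_
    rw [ContinuousLinearMap.adjoint_inner_left, inner_leftReg_left, ← hj, hu,
      ContinuousLinearMap.adjoint_inner_left]
  set k : EllTwo Γ →L[ℂ] M := p ∘L j.adjoint with hk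
  have hkE : ∀ x, k x ∈ E := fun x => E.starProjection_apply_mem _
  have hku : ∀ γ x, k (leftReg γ x) = u γ (k x) := fun γ x => by
    rw [hk, ContinuousLinearMap.comp_apply, hju, hpu, ContinuousLinearMap.comp_apply]
  have hkadj : ∀ x y, inner ℂ (k x) y = inner ℂ x (j (p y)) := fun x y => by
    rw [hk, ContinuousLinearMap.comp_apply, hpi, ContinuousLinearMap.adjoint_inner_left]
  have hk0 : ∀ x, k x = 0 → x = 0 := fun x hx => by
    refine hd.eq_zero_of_inner_left ℂ ?_
    rintro _ ⟨y, hy, rfl⟩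
    have := hkadj x y
    rw [hx, inner_zero_left, hp, Submodule.starProjection_eq_self_iff.2 hy] at this
    exact this.symm
  obtain ⟨q, hqsa, hqn, hqc⟩ := exists_abs k
  have hqu : ∀ γ x, q (leftReg γ x) = leftReg γ (q x) := fun γ x => by
    have hc : Commute (k.adjoint ∘L k) (leftReg γ) := by
      refine ContinuousLinearMap.ext fun x => ?_
      change k.adjoint (k (leftReg γ x)) = leftReg γ (k.adjoint (k x))
      rw [hku]
      refine ext_inner_right ℂ fun y => ?_
      rw [ContinuousLinearMap.adjoint_inner_left, hu, inner_leftReg_left,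
        ContinuousLinearMap.adjoint_inner_left, hku]
    exact congrArg (fun T : EllTwo Γ →L[ℂ] EllTwo Γ => T x) (hqc _ hc).eq
  -- `q = |k|` is selfadjoint and injective.
  have hqd : Dense (LinearMap.range (q : EllTwo Γ →ₗ[ℂ] EllTwo Γ) : Set (EllTwo Γ)) := by
    rw [Submodule.dense_iff_topologicalClosure_eq_top, Submodule.topologicalClosure_eq_top_iff,
      Submodule.eq_bot_iff]
    intro v hv
    refine hk0 v (norm_eq_zero.1 ?_)
    rw [← hqn, norm_eq_zero, ← inner_self_eq_zero (𝕜 := ℂ)]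
    have := (Submodule.mem_orthogonal _ _).1 hv (q (q v)) ⟨q v, rfl⟩
    rwa [← ContinuousLinearMap.adjoint_inner_right, hqsa] at this
  let D : Submodule ℂ (EllTwo Γ × M) := LinearMap.range
    ((q.prod k : EllTwo Γ →L[ℂ] EllTwo Γ × M) : EllTwo Γ →ₗ[ℂ] EllTwo Γ × M)
  obtain ⟨W, hWD, -, hWc⟩ := exists_contraction_of_relation D (by
    rintro _ ⟨x, rfl⟩
    exact (hqn x).ge)
  have hWq : ∀ x, W (q x) = k x := fun x => hWD (q x, k x) ⟨x, rfl⟩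
  have hWn : ∀ x, ‖W x‖ = ‖x‖ := fun x => by
    refine hqd.induction (P := fun x => ‖W x‖ = ‖x‖) ?_
      (isClosed_eq W.continuous.norm continuous_norm) x
    rintro _ ⟨y, rfl⟩
    exact (congrArg _ (hWq y)).trans (hqn y).symm
  have hWW : W.adjoint ∘L W = 1 := (ContinuousLinearMap.norm_map_iff_adjoint_comp_self W).1 hWn
  have hWW' : ∀ x, W.adjoint (W x) = x := fun x =>
    congrArg (fun T : EllTwo Γ →L[ℂ] EllTwo Γ => T x) hWW
  refine ⟨W, hWW, fun x => ?_, fun x hx => ?_, fun γ x => hWc _ _ ?_ ?_ x⟩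
  · refine hqd.induction (P := fun x => W x ∈ E) ?_ (hE.preimage W.continuous) x
    rintro _ ⟨y, rfl⟩
    exact (hWq y).symm ▸ hkE y
  · have hr : x ∈ (LinearMap.range (k : EllTwo Γ →ₗ[ℂ] M)).topologicalClosure := by
      rw [← Submodule.orthogonal_orthogonal_eq_closure, Submodule.mem_orthogonal]
      intro v hv
      have h1 : j (p v) = 0 := by
        refine ext_inner_left ℂ fun y => ?_
        rw [← hkadj, inner_zero_right]
        exact (Submodule.mem_orthogonal _ _).1 hv _ ⟨y, rfl⟩
      have h2 : p v = 0 := hinj _ (E.starProjection_apply_mem v) h1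
      rw [← Submodule.starProjection_eq_self_iff.2 hx, ← hpi, h2, inner_zero_left]
    refine closure_minimal (s := (LinearMap.range (k : EllTwo Γ →ₗ[ℂ] M) : Set M))
      (t := {x | W (W.adjoint x) = x}) ?_
      (isClosed_eq (W.continuous.comp W.adjoint.continuous) continuous_id) hr
    rintro _ ⟨y, rfl⟩
    change W (W.adjoint (k y)) = k y
    rw [← hWq, hWW']
  · rintro _ ⟨y, rfl⟩
    exact ⟨leftReg γ y, Prod.ext (hqu γ y) (hku γ y)⟩
  · rintro _ ⟨y, rfl⟩
    refine ⟨k (leftReg γ⁻¹ y), leftReg γ⁻¹ y, Prod.ext ?_ rfl⟩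
    rw [leftReg_adjoint]
    exact hqu γ⁻¹ y

/-- Both spaces are equivariant isometric images of `ℓ²(Γ)`, under `W` and `W'`. Then `W* W'` is an
isometry of the commutant, hence unitary, which leaves no room between `E'` and `E`. -/
theorem le_of_invariant {u : Γ → M →L[ℂ] M}
    (hu : ∀ γ x y, inner ℂ (u γ x) y = inner ℂ x (u γ⁻¹ y)) {j : M →L[ℂ] EllTwo Γ}
    (hj : ∀ γ x, j (u γ x) = leftReg γ (j x)) {E E' : Submodule ℂ M} (hE : IsClosed (E : Set M))
    (hEu : ∀ γ, ∀ x ∈ E, u γ x ∈ E) (hinj : ∀ x ∈ E, j x = 0 → x = 0)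
    (hE' : IsClosed (E' : Set M)) (hEu' : ∀ γ, ∀ x ∈ E', u γ x ∈ E') (hle : E' ≤ E)
    (hd : Dense (E'.map (j : M →ₗ[ℂ] EllTwo Γ) : Set (EllTwo Γ))) : E ≤ E' := by
  obtain ⟨W, hW1, hW2, hW3, hW4⟩ := exists_isometry_of_invariant hu hj hE hEu hinj
    (hd.mono (Submodule.map_mono hle))
  obtain ⟨W', hW1', hW2', hW3', hW4'⟩ := exists_isometry_of_invariant hu hj hE' hEu'
    (fun x hx => hinj x (hle hx)) hd
  set V := W.adjoint ∘L W' with hV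
  have hWadj : ∀ γ x, W.adjoint (u γ x) = leftReg γ (W.adjoint x) := fun γ x => by
    refine ext_inner_right ℂ fun y => ?_
    rw [ContinuousLinearMap.adjoint_inner_left, hu, inner_leftReg_left,
      ContinuousLinearMap.adjoint_inner_left, hW4]
  have hVc : CommLeft V := fun γ x => by
    rw [hV, ContinuousLinearMap.comp_apply, hW4', hWadj, ContinuousLinearMap.comp_apply]
  have hVV : V.adjoint ∘L V = 1 := by
    rw [← hW1', hV, ContinuousLinearMap.adjoint_comp, ContinuousLinearMap.adjoint_adjoint]
    ext1 x
    simp only [ContinuousLinearMap.comp_apply]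
    rw [hW3 _ (hle (hW2' x))]
  have hVV' := hVc.comp_adjoint_of_isometry hVV
  intro x hx
  have h1 : V (V.adjoint (W.adjoint x)) = W.adjoint x :=
    congrArg (fun T : EllTwo Γ →L[ℂ] EllTwo Γ => T (W.adjoint x)) hVV'
  rw [← hW3 x hx, ← h1, hV, ContinuousLinearMap.comp_apply, hW3 _ (hle (hW2' _))]
  exact hW2' _

/-- An invariant subspace with dense first projection of the graph of a closed invariant operator
is dense in that graph. -/
theorem le_topologicalClosure_of_invariant {v : Γ → M →L[ℂ] M}
    (hv : ∀ γ x y, inner ℂ (v γ x) y = inner ℂ x (v γ⁻¹ y))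
    {G g : Submodule ℂ (EllTwo Γ × M)} (hG : IsClosed (G : Set (EllTwo Γ × M)))
    (hGv : ∀ γ, ∀ p ∈ G, (leftReg γ p.1, v γ p.2) ∈ G) (hfun : ∀ p ∈ G, p.1 = 0 → p.2 = 0)
    (hgv : ∀ γ, ∀ p ∈ g, (leftReg γ p.1, v γ p.2) ∈ g) (hle : g ≤ G)
    (hd : Dense (g.map (LinearMap.fst ℂ (EllTwo Γ) M) : Set (EllTwo Γ))) :
    G ≤ g.topologicalClosure := by
  let e := WithLp.prodContinuousLinearEquiv 2 ℂ (EllTwo Γ) M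
  let u : Γ → WithLp 2 (EllTwo Γ × M) →L[ℂ] WithLp 2 (EllTwo Γ × M) := fun γ =>
    e.symm.toContinuousLinearMap ∘L ((leftReg γ).prodMap (v γ)) ∘L e.toContinuousLinearMap
  let j : WithLp 2 (EllTwo Γ × M) →L[ℂ] EllTwo Γ :=
    ContinuousLinearMap.fst ℂ (EllTwo Γ) M ∘L e.toContinuousLinearMap
  let T : Submodule ℂ (EllTwo Γ × M) → Submodule ℂ (WithLp 2 (EllTwo Γ × M)) :=
    fun s => s.comap (e.toContinuousLinearMap : WithLp 2 (EllTwo Γ × M) →ₗ[ℂ] EllTwo Γ × M)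
  have hcl : ∀ p ∈ g.topologicalClosure, ∀ γ, (leftReg γ p.1, v γ p.2) ∈ g.topologicalClosure := by
    intro p hp γ
    exact map_mem_closure (s := (g : Set _)) (t := (g : Set _))
      ((leftReg γ).prodMap (v γ)).continuous hp fun q hq => hgv γ q hq
  have key : T G ≤ T g.topologicalClosure := by
    refine le_of_invariant (u := u) (j := j) ?_ (fun γ x => rfl)
      (hG.preimage e.continuous) (fun γ x hx => hGv γ _ hx) ?_
      (g.isClosed_topologicalClosure.preimage e.continuous) (fun γ x hx => hcl _ hx γ)
      (fun x hx => ?_) ?_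
    · intro γ x y
      rw [WithLp.prod_inner_apply, WithLp.prod_inner_apply]
      exact congrArg₂ (· + ·) (inner_leftReg_left _ _ _) (hv _ _ _)
    · intro x hx hx0
      have h2 := hfun _ hx hx0
      exact e.injective (Prod.ext hx0 h2)
    · exact closure_minimal (s := (g : Set (EllTwo Γ × M))) hle hG hx
    · refine hd.mono ?_
      rintro _ ⟨p, hp, rfl⟩
      exact ⟨e.symm p, g.le_topologicalClosure hp, rfl⟩
  intro p hp
  exact key (x := e.symm p) hp

end Maximality

/-- Invariance of a partially defined operator under the left regular representation. -/
def LeftInv (A : EllTwo Γ →ₗ.[ℂ] EllTwo Γ) : Prop :=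
  ∀ γ x y, (x, y) ∈ A.graph → (leftReg γ x, leftReg γ y) ∈ A.graph

variable {A B : EllTwo Γ →ₗ.[ℂ] EllTwo Γ}

theorem LeftInv.le_topologicalClosure (hA : LeftInv A) (hc : A.IsClosed)
    {g : Submodule ℂ (EllTwo Γ × EllTwo Γ)}
    (hg : ∀ γ, ∀ p ∈ g, (leftReg γ p.1, leftReg γ p.2) ∈ g) (hle : g ≤ A.graph)
    (hd : Dense (g.map (LinearMap.fst ℂ (EllTwo Γ) (EllTwo Γ)) : Set (EllTwo Γ))) :
    A.graph ≤ g.topologicalClosure :=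
  le_topologicalClosure_of_invariant inner_leftReg_left hc (fun γ _ hp => hA γ _ _ hp)
    (fun _ hp h => A.graph_fst_eq_zero_snd hp h) hg hle hd

/-- Apply maximality of `B` to the subspace `A.graph`, which is closed already. -/
theorem LeftInv.eq_of_le (hA : LeftInv A) (hcA : A.IsClosed)
    (hd : Dense (A.domain : Set (EllTwo Γ)))
    (hB : LeftInv B) (hcB : B.IsClosed) (h : A ≤ B) : A = B := by
  refine LinearPMap.eq_of_eq_graph (le_antisymm (LinearPMap.le_graph_of_le h) ?_)
  have := hB.le_topologicalClosure hcB (g := A.graph) (fun γ _ hp => hA γ _ _ hp)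
    (LinearPMap.le_graph_of_le h) (by rwa [LinearPMap.graph_map_fst_eq_domain])
  exact this.trans (A.graph.topologicalClosure_minimal le_rfl hcA)

theorem LeftInv.adjoint (hA : LeftInv A) (hd : Dense (A.domain : Set (EllTwo Γ))) :
    LeftInv A.adjoint := by
  intro γ y z h
  rw [mem_graph_adjoint hd] at h ⊢
  intro x w hxw
  rw [← inv_inv γ, ← inner_leftReg_left, ← inner_leftReg_left]
  exact h _ _ (hA _ _ _ hxw)

theorem LeftInv.opComp (hA : LeftInv A) (hB : LeftInv B) : LeftInv (opComp A B) := by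
  intro γ x z h
  obtain ⟨y, h1, h2⟩ := mem_graph_opComp.1 h
  exact mem_graph_opComp.2 ⟨_, hB _ _ _ h1, hA _ _ _ h2⟩

theorem LeftInv.bddOp {T : EllTwo Γ →L[ℂ] EllTwo Γ} (hT : CommLeft T) : LeftInv (bddOp T) := by
  intro γ x y h
  rw [mem_graph_bddOp] at h ⊢
  rw [hT, h]

theorem IsOpSqrt.leftInv {P S : EllTwo Γ →ₗ.[ℂ] EllTwo Γ} (h : IsOpSqrt P S) (hP : LeftInv P) :
    LeftInv S :=
  fun γ _ _ => h.commutes fun x y => hP γ x y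

/-- `ℓ₀(Γ)` is a core: the translates of `δ_e` span an invariant dense subspace, so maximality
applies. -/
theorem LeftInv.graph_le_span (hA : LeftInv A) (hc : A.IsClosed)
    {s : EllTwo Γ} (hs : (deltaOne Γ, s) ∈ A.graph) :
    A.graph ≤ (Submodule.span ℂ (Set.range fun γ : Γ =>
      (leftReg γ (deltaOne Γ), leftReg γ s))).topologicalClosure := by
  refine hA.le_topologicalClosure hc (fun γ p hp => ?_) ?_ ?_
  · exact prodMap_mem_span (a := leftReg γ) (b := leftReg γ)
      (u := fun a => leftReg a (deltaOne Γ)) (v := fun a => leftReg a s)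
      (fun a => ⟨γ * a, leftReg_leftReg γ a _, leftReg_leftReg γ a _⟩) hp
  · refine Submodule.span_le.2 ?_
    rintro _ ⟨a, rfl⟩
    exact hA _ _ _ hs
  · refine dense_range_deltaComb.mono ?_
    rw [deltaComb, Finsupp.range_linearCombination, Submodule.map_span, ← Set.range_comp]
    rfl

/-- If the domain of a closed invariant operator `A` contains `δ_e`, then the domain of its adjoint
contains the orbit of `δ_e` under the commutant of the left regular representation. -/
theorem LeftInv.mem_adjoint (hA : LeftInv A) (hc : A.IsClosed)
    {s : EllTwo Γ} (hs : (deltaOne Γ, s) ∈ A.graph) (hd : Dense (A.domain : Set (EllTwo Γ)))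
    {T : EllTwo Γ →L[ℂ] EllTwo Γ} (hT : CommLeft T) :
    (T (deltaOne Γ), reflectConj (T.adjoint s)) ∈ A.adjoint.graph := by
  rw [mem_graph_adjoint hd]
  intro x w hxw
  have hclosed : IsClosed {p : EllTwo Γ × EllTwo Γ |
      inner ℂ p.2 (T (deltaOne Γ)) = inner ℂ p.1 (reflectConj (T.adjoint s))} :=
    isClosed_eq (continuous_snd.inner continuous_const) (continuous_fst.inner continuous_const)
  -- By the core property it is enough to test against the translates of `(δ_e, s)`.
  refine closure_minimal (fun p hp => ?_) hclosed (hA.graph_le_span hc hs hxw)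
  induction hp using Submodule.span_induction with
  | mem p hp =>
    obtain ⟨a, rfl⟩ := hp
    change inner ℂ (leftReg a s) (T (deltaOne Γ)) =
      inner ℂ (leftReg a (deltaOne Γ)) (reflectConj (T.adjoint s))
    rw [inner_leftReg_deltaOne, reflectConj_apply, ← inner_leftReg_deltaOne, inner_conj_symm,
      ContinuousLinearMap.adjoint_inner_left, inner_leftReg_left, hT]
  | zero => simp
  | add p q _ _ hp hq =>
    simp only [Set.mem_ofPred_eq, Prod.fst_add, Prod.snd_add, inner_add_left] at hp hq ⊢
    rw [hp, hq]
  | smul c p _ hp =>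
    simp only [Set.mem_ofPred_eq, Prod.smul_fst, Prod.smul_snd, inner_smul_left] at hp ⊢
    rw [hp]

theorem LeftInv.mem_of_isSelfAdjoint (hA : LeftInv A) (hsa : IsSelfAdjoint A)
    {s : EllTwo Γ} (hs : (deltaOne Γ, s) ∈ A.graph)
    {T : EllTwo Γ →L[ℂ] EllTwo Γ} (hT : CommLeft T) :
    (T (deltaOne Γ), reflectConj (T.adjoint s)) ∈ A.graph := by
  have := hA.mem_adjoint hsa.isClosed hs hsa.dense_domain hT
  rwa [LinearPMap.isSelfAdjoint_def.1 hsa] at this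

end RegularRepresentation

/-! ### Closedness under bounded perturbations. -/

section BoundedPerturbation

variable {E F : Type*} [NormedAddCommGroup E] [InnerProductSpace ℂ E] [CompleteSpace E]
  [NormedAddCommGroup F] [InnerProductSpace ℂ F] [CompleteSpace F]

theorem norm_adjoint_apply_le {A : E →L[ℂ] F} (hA : ∀ x, ‖A x‖ ≤ ‖x‖) (y : F) :
    ‖A.adjoint y‖ ≤ ‖y‖ := by
  have h1 : ‖A‖ ≤ 1 := A.opNorm_le_bound zero_le_one fun x => by rw [one_mul]; exact hA x
  have h2 : ‖A.adjoint‖ ≤ 1 := by rwa [LinearIsometryEquiv.norm_map]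
  simpa using A.adjoint.le_of_opNorm_le h2 y

theorem opComp_bddOp_isClosed {A : E →ₗ.[ℂ] F} (hA : A.IsClosed) (T : E →L[ℂ] E) :
    (opComp A (bddOp T)).IsClosed := by
  have : ((opComp A (bddOp T)).graph : Set (E × F)) = (fun p => (T p.1, p.2)) ⁻¹' A.graph := by
    ext ⟨x, y⟩
    simp only [SetLike.mem_coe, mem_graph_opComp, mem_graph_bddOp, exists_eq_left',
      Set.mem_preimage]
  rw [LinearPMap.IsClosed, this]
  exact IsClosed.preimage (by fun_prop) hA

theorem sub_bddOp_isClosed {A : E →ₗ.[ℂ] F} (hA : A.IsClosed) (T : E →L[ℂ] F) :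
    (A - bddOp T).IsClosed := by
  have : ((A - bddOp T).graph : Set (E × F)) = (fun p => (p.1, p.2 + T p.1)) ⁻¹' A.graph := by
    ext ⟨x, y⟩
    simp only [SetLike.mem_coe, mem_graph_sub_bddOp, Set.mem_preimage]
  rw [LinearPMap.IsClosed, this]
  exact IsClosed.preimage (by fun_prop) hA

theorem sub_bddOp_domain (A : E →ₗ.[ℂ] F) (T : E →L[ℂ] F) : (A - bddOp T).domain = A.domain :=
  inf_top_eq _

end BoundedPerturbation

/-! ### Polar factorization in `L¹` and continuity of the trace. -/

section Trace

variable {Γ : Type*} [Group Γ] {F S P : EllTwo Γ →ₗ.[ℂ] EllTwo Γ}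

theorem CommLeft.of_mem_trigPoly {T : EllTwo Γ →L[ℂ] EllTwo Γ} (hT : T ∈ trigPoly Γ) :
    CommLeft T := by
  induction hT using Submodule.span_induction with
  | mem T hT =>
    obtain ⟨γ, rfl⟩ := hT
    exact CommLeft.rightReg γ
  | zero => exact fun γ x => by simp
  | add A B _ _ hA hB => exact fun γ x => by simp [hA γ x, hB γ x]
  | smul c A _ hA => exact fun γ x => by simp [hA γ x]

theorem IsAffiliated.leftInv (h : IsAffiliated F) : LeftInv F := by
  intro γ x y hxy
  obtain ⟨hx, rfl⟩ := LinearPMap.mem_graph_pair.1 hxy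
  refine LinearPMap.mem_graph_pair.2 (h.comm (leftReg γ) ?_ ?_ ⟨x, hx⟩)
  · exact Set.subset_centralizer_centralizer ⟨γ, rfl⟩
  · rw [Unitary.mem_iff, ContinuousLinearMap.star_eq_adjoint, leftReg_adjoint]
    constructor <;> ext1 u
    · exact (leftReg_leftReg _ _ _).trans (by rw [inv_mul_cancel, leftReg_one]; rfl)
    · exact (leftReg_leftReg _ _ _).trans (by rw [mul_inv_cancel, leftReg_one]; rfl)

theorem opComp_rightReg_dense (hd : Dense (F.domain : Set (EllTwo Γ))) (γ : Γ) :
    Dense ((opComp F (bddOp (rightReg γ))).domain : Set (EllTwo Γ)) := by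
  have hs : Function.Surjective (rightReg γ⁻¹ : EllTwo Γ →L[ℂ] EllTwo Γ) := fun x =>
    ⟨rightReg γ x, by rw [rightReg_rightReg, inv_mul_cancel, rightReg_one]⟩
  refine (hs.denseRange.dense_image (rightReg γ⁻¹).continuous hd).mono ?_
  rintro _ ⟨x, hx, rfl⟩
  obtain ⟨y, hy⟩ := LinearPMap.mem_domain_iff.1 hx
  refine LinearPMap.mem_domain_iff.2 ⟨y, mem_graph_opComp.2 ⟨x, ?_, hy⟩⟩
  rw [mem_graph_bddOp, rightReg_rightReg, mul_inv_cancel, rightReg_one]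

/-- A factorization `F = U S S` with `S` positive selfadjoint, `δ_e ∈ Dom S` and `U` a contraction,
all commuting with the left regular representation. -/
structure IsPolarFactor (F S : EllTwo Γ →ₗ.[ℂ] EllTwo Γ) (U : EllTwo Γ →L[ℂ] EllTwo Γ)
    (s : EllTwo Γ) : Prop where
  pos : IsPosSelfAdjoint S
  inv : LeftInv S
  comm : CommLeft U
  norm_le : ∀ x, ‖U x‖ ≤ ‖x‖
  mem : (deltaOne Γ, s) ∈ S.graph
  mem_graph_iff : ∀ x f, (x, f) ∈ F.graph ↔ ∃ p, (x, p) ∈ (opComp S S).graph ∧ U p = f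

/-- As `‖F x‖ = ‖P x‖` on a common domain, `P x ↦ F x` is an isometric relation. It and its domain
are invariant under all `λ(γ)`, and `λ(γ)* = λ(γ⁻¹)`, so the extension `U` commutes with `λ`. -/
theorem IsOpAbs.exists_contraction (hP : IsOpAbs F P) (hF : LeftInv F) (hc : F.IsClosed)
    (hd : Dense (F.domain : Set (EllTwo Γ))) :
    ∃ U : EllTwo Γ →L[ℂ] EllTwo Γ, CommLeft U ∧ (∀ x, ‖U x‖ ≤ ‖x‖) ∧
      ∀ x f, (x, f) ∈ F.graph ↔ ∃ p, (x, p) ∈ P.graph ∧ U p = f := by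
  have hPinv : LeftInv P := hP.leftInv ((hF.adjoint hd).opComp hF)
  have hadj : opComp P.adjoint P = opComp F.adjoint F := by
    rw [LinearPMap.isSelfAdjoint_def.1 hP.1.1, hP.2]
  let D : Submodule ℂ (EllTwo Γ × EllTwo Γ) :=
    { carrier := {p | ∃ x, (x, p.1) ∈ P.graph ∧ (x, p.2) ∈ F.graph}
      zero_mem' := ⟨0, P.graph.zero_mem, F.graph.zero_mem⟩
      add_mem' := by
        rintro p q ⟨x, h1, h2⟩ ⟨y, h3, h4⟩
        exact ⟨x + y, P.graph.add_mem h1 h3, F.graph.add_mem h2 h4⟩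
      smul_mem' := by
        rintro c p ⟨x, h1, h2⟩
        exact ⟨c • x, P.graph.smul_mem c h1, F.graph.smul_mem c h2⟩ }
  have hPF : ∀ x p, (x, p) ∈ P.graph → ∃ w, (x, w) ∈ F.graph ∧ ‖w‖ = ‖p‖ := fun x p =>
    exists_norm_eq_of_adjoint_comp_eq hP.1.1.isClosed hP.1.1.dense_domain hc hd hadj
  have hFP : ∀ x p, (x, p) ∈ F.graph → ∃ w, (x, w) ∈ P.graph ∧ ‖w‖ = ‖p‖ := fun x p =>
    exists_norm_eq_of_adjoint_comp_eq hc hd hP.1.1.isClosed hP.1.1.dense_domain hadj.symm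
  obtain ⟨U, h1, h2, h3⟩ := exists_contraction_of_relation D (by
    rintro p ⟨x, hx1, hx2⟩
    obtain ⟨w, hw, hn⟩ := hPF _ _ hx1
    rw [← hn, F.graph_functional hx2 hw])
  refine ⟨U, fun γ => h3 _ _ ?_ ?_, h2, fun x f => ⟨fun hf => ?_, ?_⟩⟩
  · rintro p ⟨x, hx1, hx2⟩
    exact ⟨leftReg γ x, hPinv _ _ _ hx1, hF _ _ _ hx2⟩
  · rintro p ⟨x, hx1, hx2⟩
    rw [leftReg_adjoint]
    exact ⟨leftReg γ⁻¹ p.2, leftReg γ⁻¹ x, hPinv _ _ _ hx1, hF _ _ _ hx2⟩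
  · obtain ⟨w, hw, -⟩ := hFP _ _ hf
    exact ⟨w, hw, h1 (w, f) ⟨x, hw, hf⟩⟩
  · rintro ⟨p, hp, rfl⟩
    obtain ⟨w, hw, -⟩ := hPF _ _ hp
    rwa [h1 (p, w) ⟨x, hp, hw⟩]

theorem IsOpAbs.exists_isPolarFactor (hP : IsOpAbs F P) (hF : LeftInv F) (hc : F.IsClosed)
    (hd : Dense (F.domain : Set (EllTwo Γ))) (hS : IsOpSqrt P S) (h : deltaOne Γ ∈ S.domain) :
    ∃ U, IsPolarFactor F S U (S ⟨deltaOne Γ, h⟩) := by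
  obtain ⟨U, h1, h2, h3⟩ := hP.exists_contraction hF hc hd
  exact ⟨U, hS.1, hS.leftInv (hP.leftInv ((hF.adjoint hd).opComp hF)), h1, h2,
    LinearPMap.mem_graph_mk h, by rwa [hS.2]⟩

/-- An infimum over an empty family is `∞`, so a finite norm provides `|F|`, its root and `δ_e` in
the domain of the root. -/
theorem exists_of_oneNorm_lt_top (h : oneNorm F < ∞) : ∃ P, IsOpAbs F P ∧
    ∃ S, IsOpSqrt P S ∧ deltaOne Γ ∈ S.domain := by
  simp only [oneNorm, posTrace, iInf_lt_iff] at h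
  obtain ⟨P, hP, S, hS, hδ, -⟩ := h
  exact ⟨P, hP, S, hS, hδ⟩

namespace IsPolarFactor

variable {U : EllTwo Γ →L[ℂ] EllTwo Γ} {s : EllTwo Γ}

theorem mem_adjoint_deltaOne (h : IsPolarFactor F S U s) {A : EllTwo Γ →L[ℂ] EllTwo Γ}
    (hA : CommLeft A) : (A.adjoint (deltaOne Γ), reflectConj (A s)) ∈ S.graph := by
  have := h.inv.mem_of_isSelfAdjoint h.pos.1 h.mem hA.adjoint
  rwa [ContinuousLinearMap.adjoint_adjoint] at this

theorem inner_eq (h : IsPolarFactor F S U s) {q p : EllTwo Γ} (hq : (q, p) ∈ S.graph) :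
    inner ℂ (deltaOne Γ) (U p) = inner ℂ (reflectConj (U s)) q := by
  rw [← ContinuousLinearMap.adjoint_inner_left]
  exact (h.pos.1.mem_graph_iff.1 hq _ _ (h.mem_adjoint_deltaOne h.comm)).symm

/-- The bound `|τ(FA)| ≤ τ(|F|)`: moving one factor `S` of `F = U S S` to the left gives `⟨(Us)*, S
A δ_e⟩` with `S A δ_e = (A* s)*`, and Cauchy–Schwarz applies. -/
theorem norm_inner_le (h : IsPolarFactor F S U s) {A : EllTwo Γ →L[ℂ] EllTwo Γ}
    (hA : CommLeft A) (hA1 : ∀ x, ‖A x‖ ≤ ‖x‖) {f : EllTwo Γ}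
    (hf : (A (deltaOne Γ), f) ∈ F.graph) : ‖inner ℂ (deltaOne Γ) f‖ ≤ ‖s‖ ^ 2 := by
  obtain ⟨p, hp, rfl⟩ := (h.mem_graph_iff _ _).1 hf
  obtain ⟨q, hq, hqp⟩ := mem_graph_opComp.1 hp
  have e := S.graph_functional hq (h.inv.mem_of_isSelfAdjoint h.pos.1 h.mem hA)
  rw [h.inner_eq hqp, pow_two]
  refine (norm_inner_le_norm _ _).trans (mul_le_mul ?_ ?_ (norm_nonneg _) (norm_nonneg _))
  · rw [norm_reflectConj]
    exact h.norm_le s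
  · rw [e, norm_reflectConj]
    exact norm_adjoint_apply_le hA1 s

end IsPolarFactor

theorem enorm_inner_le_oneNorm (hF : LeftInv F) (hc : F.IsClosed)
    (hd : Dense (F.domain : Set (EllTwo Γ))) {A : EllTwo Γ →L[ℂ] EllTwo Γ}
    (hA : CommLeft A) (hA1 : ∀ x, ‖A x‖ ≤ ‖x‖) {f : EllTwo Γ}
    (hf : (A (deltaOne Γ), f) ∈ F.graph) : ‖inner ℂ (deltaOne Γ) f‖ₑ ≤ oneNorm F := by
  refine le_iInf₂ fun P hP => le_iInf₂ fun S hS => le_iInf fun h => ?_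
  obtain ⟨U, hU⟩ := hP.exists_isPolarFactor hF hc hd hS h
  have := hU.norm_inner_le hA hA1 hf
  rw [← ofReal_norm, ← ofReal_norm, ← ENNReal.ofReal_pow (norm_nonneg _)]
  exact ENNReal.ofReal_le_ofReal this

theorem IsResolvent.commLeft {ε : ℝ} {R Q : EllTwo Γ →L[ℂ] EllTwo Γ} (h : IsResolvent S ε R Q)
    (hS : IsPosSelfAdjoint S) (hinv : LeftInv S) : CommLeft R ∧ CommLeft Q := by
  have := fun γ : Γ => h.commute hS (B := leftReg γ) (hinv.opComp hinv γ)
  exact ⟨fun γ x => congrArg (fun T : EllTwo Γ →L[ℂ] EllTwo Γ => T x) (this γ).1.eq,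
    fun γ x => congrArg (fun T : EllTwo Γ →L[ℂ] EllTwo Γ => T x) (this γ).2.eq⟩

/-- The trace of `F ρ(γ)` in terms of a factorization of `F`. -/
theorem HasTrace.eq_inner {U : EllTwo Γ →L[ℂ] EllTwo Γ} {s : EllTwo Γ} {γ : Γ} {z : ℂ}
    (ht : HasTrace (opComp F (bddOp (rightReg γ))) z) (h : IsPolarFactor F S U s)
    (hF : LeftInv F) (hc : F.IsClosed) (hd : Dense (F.domain : Set (EllTwo Γ))) :
    z = inner ℂ (reflectConj (U s)) (leftReg γ⁻¹ s) := by
  obtain ⟨T, hT, hz⟩ := ht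
  refine tendsto_nhds_unique hz ?_
  rw [tendsto_iff_edist_tendsto_0]
  refine tendsto_of_tendsto_of_tendsto_of_le_of_le tendsto_const_nhds hT (fun _ => zero_le)
    fun n => ?_
  set B := (T n : EllTwo Γ →L[ℂ] EllTwo Γ)
  have hB : CommLeft B := CommLeft.of_mem_trigPoly (T n).2
  -- The aim is to bound the distance of `τ(B)` from the claimed value by `‖F ρ(γ) - B‖₁`. Since
  -- `δ_e` need not lie in the domain of `F'`, it is replaced by regularized vectors.
  set F' := opComp F (bddOp (rightReg γ)) - bddOp B with hF'
  have hc' : F'.IsClosed := sub_bddOp_isClosed (opComp_bddOp_isClosed hc _) _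
  have hd' : Dense (F'.domain : Set (EllTwo Γ)) := by
    rw [hF', sub_bddOp_domain]
    exact opComp_rightReg_dense hd γ
  have hinv' : LeftInv F' := by
    intro a x y hxy
    rw [hF', mem_graph_sub_bddOp] at hxy ⊢
    rw [hB, ← map_add]
    exact hF.opComp (LeftInv.bddOp (CommLeft.rightReg γ)) _ _ _ hxy
  obtain ⟨ε, R, Q, hr, hR, hQ⟩ := exists_resolvent_seq h.pos.1.isClosed h.pos.1.dense_domain
  set x := leftReg γ⁻¹ (deltaOne Γ) with hx
  have hxs : (x, leftReg γ⁻¹ s) ∈ S.graph := h.inv _ _ _ h.mem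
  -- Conjugation by `ρ(γ)` is chosen so that `ρ(γ) A k δ_e = R k x` lies in `Dom S² = Dom F`, while
  -- `A k δ_e → δ_e`.
  let A : ℕ → EllTwo Γ →L[ℂ] EllTwo Γ := fun k => rightReg γ⁻¹ ∘L R k ∘L rightReg γ
  have hAc : ∀ k, CommLeft (A k) := fun k =>
    (CommLeft.rightReg _).comp (((hr k).commLeft h.pos h.inv).1.comp (CommLeft.rightReg _))
  have hA1 : ∀ k y, ‖A k y‖ ≤ ‖y‖ := fun k y => by
    change ‖rightReg γ⁻¹ (R k (rightReg γ y))‖ ≤ ‖y‖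
    rw [norm_rightReg]
    exact ((hr k).norm_le _).trans (norm_rightReg _ _).le
  have hAδ : ∀ k, A k (deltaOne Γ) = rightReg γ⁻¹ (R k x) := fun k => by
    change rightReg γ⁻¹ (R k (rightReg γ (deltaOne Γ))) = _
    rw [rightReg_deltaOne]
  have hlim1 : Tendsto (fun k => B (A k (deltaOne Γ))) atTop (𝓝 (B (deltaOne Γ))) := by
    have : rightReg γ⁻¹ x = deltaOne Γ := by
      rw [hx, ← rightReg_deltaOne, rightReg_rightReg, inv_mul_cancel, rightReg_one]
    simp only [hAδ]
    conv => rhs; rw [← this]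
    exact ((B.continuous.comp (rightReg γ⁻¹).continuous).tendsto x).comp (hR x)
  let p : ℕ → EllTwo Γ := fun k => ((ε k : ℂ))⁻¹ • (x - R k x)
  have hp : ∀ k, (Q k x, p k) ∈ S.graph := fun k => (hr k).mem_of_isSelfAdjoint h.pos.1 x
  have hmem : ∀ k, (A k (deltaOne Γ), U (p k) - B (A k (deltaOne Γ))) ∈ F'.graph := fun k => by
    rw [hF', mem_graph_sub_bddOp, sub_add_cancel, mem_graph_opComp]
    refine ⟨R k x, ?_, (h.mem_graph_iff _ _).2 ⟨p k, (hr k).mem_opComp h.pos.1 x, rfl⟩⟩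
    rw [mem_graph_bddOp, hAδ, rightReg_rightReg, mul_inv_cancel, rightReg_one]
  have hle : ∀ k, ‖inner ℂ (deltaOne Γ) (U (p k) - B (A k (deltaOne Γ)))‖ₑ ≤ oneNorm F' := fun k =>
    enorm_inner_le_oneNorm hinv' hc' hd' (hAc k) (hA1 k) (hmem k)
  -- The vectors `p k = S² R k x` need not converge, but only `S R k x = Q k x` enters after one `S`
  -- is moved, and it tends to `S x`.
  have hlim : Tendsto (fun k => inner ℂ (deltaOne Γ) (U (p k) - B (A k (deltaOne Γ)))) atTop
      (𝓝 (inner ℂ (reflectConj (U s)) (leftReg γ⁻¹ s) -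
        inner ℂ (deltaOne Γ) (B (deltaOne Γ)))) := by
    simp only [inner_sub_right, h.inner_eq (hp _)]
    exact (tendsto_const_nhds.inner (hQ x _ hxs)).sub (tendsto_const_nhds.inner hlim1)
  have := le_of_tendsto hlim.enorm (Eventually.of_forall hle)
  rwa [edist_comm, edist_eq_enorm_sub]

end Trace

/-! ### Sesquilinear forms determined by Gram matrices. -/

section Form

variable {Γ : Type*} {X Y : Type*} [NormedAddCommGroup X] [InnerProductSpace ℂ X]
  [NormedAddCommGroup Y] [InnerProductSpace ℂ Y]

theorem inner_linearCombination_eq {u v : Γ → X} {u' v' : Γ → Y}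
    (h : ∀ a b, inner ℂ (u b) (v a) = inner ℂ (u' b) (v' a)) (f g : Γ →₀ ℂ) :
    inner ℂ (Finsupp.linearCombination ℂ u g) (Finsupp.linearCombination ℂ v f) =
      inner ℂ (Finsupp.linearCombination ℂ u' g) (Finsupp.linearCombination ℂ v' f) := by
  simp only [Finsupp.linearCombination_apply, Finsupp.sum, sum_inner, inner_sum, inner_smul_left,
    inner_smul_right, h]

end Form

/-! ### Positivity of the bracket `[ψ,ψ]`. -/

section SelfAdjoint

variable {Γ : Type*} [Group Γ] {F S : EllTwo Γ →ₗ.[ℂ] EllTwo Γ}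
  {U : EllTwo Γ →L[ℂ] EllTwo Γ} {s : EllTwo Γ}

/-- Symmetry means `F ⊆ F*`; both are closed and invariant, so maximality gives equality. -/
theorem isPosSelfAdjoint_of_formal (hF : LeftInv F) (hc : F.IsClosed)
    (hd : Dense (F.domain : Set (EllTwo Γ)))
    (hsym : ∀ p ∈ F.graph, ∀ q ∈ F.graph, inner ℂ p.1 q.2 = inner ℂ p.2 q.1)
    (hpos : ∀ p ∈ F.graph, 0 ≤ (inner ℂ p.1 p.2).re) : IsPosSelfAdjoint F := by
  have hle : F ≤ F.adjoint := by
    refine LinearPMap.le_of_le_graph ?_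
    rintro ⟨y, z⟩ hyz
    rw [mem_graph_adjoint hd]
    exact fun x w hxw => (hsym _ hxw _ hyz).symm
  refine ⟨LinearPMap.isSelfAdjoint_def.2 (hF.eq_of_le hc hd (hF.adjoint hd)
    (LinearPMap.adjoint_isClosed hd) hle).symm, fun x => hpos _ (F.mem_graph x)⟩

/-- The joint graph of `S` and `S U*`. -/
def jointGraph (S : EllTwo Γ →ₗ.[ℂ] EllTwo Γ) (U : EllTwo Γ →L[ℂ] EllTwo Γ) :
    Submodule ℂ (EllTwo Γ × WithLp 2 (EllTwo Γ × EllTwo Γ)) where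
  carrier := {p | (p.1, p.2.fst) ∈ S.graph ∧ (U.adjoint p.1, p.2.snd) ∈ S.graph}
  zero_mem' := ⟨S.graph.zero_mem, by
    have : ((U.adjoint 0 : EllTwo Γ), (0 : EllTwo Γ)) ∈ S.graph := by
      rw [map_zero]
      exact S.graph.zero_mem
    exact this⟩
  add_mem' := by
    rintro p q ⟨h1, h2⟩ ⟨h3, h4⟩
    refine ⟨S.graph.add_mem h1 h3, ?_⟩
    have := S.graph.add_mem h2 h4
    rw [Prod.mk_add_mk, ← map_add] at this
    exact this
  smul_mem' := by
    rintro c p ⟨h1, h2⟩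
    refine ⟨S.graph.smul_mem c h1, ?_⟩
    have := S.graph.smul_mem c h2
    rw [Prod.smul_mk, ← map_smul] at this
    exact this

theorem jointGraph_isClosed (hS : S.IsClosed) :
    IsClosed (jointGraph S U : Set (EllTwo Γ × WithLp 2 (EllTwo Γ × EllTwo Γ))) := by
  have h1 : Continuous fun p : EllTwo Γ × WithLp 2 (EllTwo Γ × EllTwo Γ) => (p.1, p.2.fst) :=
    continuous_fst.prodMk ((WithLp.fstL 2 ℂ (EllTwo Γ) (EllTwo Γ)).continuous.comp continuous_snd)
  have h2 : Continuous fun p : EllTwo Γ × WithLp 2 (EllTwo Γ × EllTwo Γ) =>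
      (U.adjoint p.1, p.2.snd) :=
    (U.adjoint.continuous.comp continuous_fst).prodMk
      ((WithLp.sndL 2 ℂ (EllTwo Γ) (EllTwo Γ)).continuous.comp continuous_snd)
  exact (IsClosed.preimage h1 hS).inter (IsClosed.preimage h2 hS)

namespace IsPolarFactor

/-- The part of the joint graph of `S` and `S U*` over `ℓ₀(Γ)`. -/
def jointCore (U : EllTwo Γ →L[ℂ] EllTwo Γ) (s : EllTwo Γ) :
    (Γ →₀ ℂ) →ₗ[ℂ] EllTwo Γ × WithLp 2 (EllTwo Γ × EllTwo Γ) :=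
  Finsupp.linearCombination ℂ fun γ : Γ => (leftReg γ (deltaOne Γ),
    WithLp.toLp 2 (leftReg γ s, leftReg γ (reflectConj (U s))))

theorem jointCore_fst (f : Γ →₀ ℂ) :
    (jointCore U s f).2.fst = Finsupp.linearCombination ℂ (fun a => leftReg a s) f := by
  induction f using Finsupp.induction_linear with
  | zero => rw [map_zero, map_zero]; rfl
  | add f g hf hg => rw [map_add, map_add, ← hf, ← hg]; rfl
  | single a c =>
    rw [jointCore, Finsupp.linearCombination_single, Finsupp.linearCombination_single]
    rfl

theorem jointCore_snd (f : Γ →₀ ℂ) : (jointCore U s f).2.snd =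
    Finsupp.linearCombination ℂ (fun a => leftReg a (reflectConj (U s))) f := by
  induction f using Finsupp.induction_linear with
  | zero => rw [map_zero, map_zero]; rfl
  | add f g hf hg => rw [map_add, map_add, ← hf, ← hg]; rfl
  | single a c =>
    rw [jointCore, Finsupp.linearCombination_single, Finsupp.linearCombination_single]
    rfl

/-- `ℓ₀(Γ)` is a core for `S` and `S U*` simultaneously: `x ↦ (S x, S U* x)` is one closed invariant
operator with values in a Hilbert sum, and `δ_e` is in its domain. Cores for each separately would
not suffice for mixed forms. -/
theorem jointGraph_le (h : IsPolarFactor F S U s) :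
    jointGraph S U ≤ (LinearMap.range (jointCore U s)).topologicalClosure := by
  have hspan : LinearMap.range (jointCore U s) = Submodule.span ℂ (Set.range fun γ : Γ =>
      (leftReg γ (deltaOne Γ),
        WithLp.toLp 2 (leftReg γ s, leftReg γ (reflectConj (U s))))) :=
    Finsupp.range_linearCombination _
  let e := WithLp.prodContinuousLinearEquiv 2 ℂ (EllTwo Γ) (EllTwo Γ)
  let v : Γ → WithLp 2 (EllTwo Γ × EllTwo Γ) →L[ℂ] WithLp 2 (EllTwo Γ × EllTwo Γ) := fun γ =>
    e.symm.toContinuousLinearMap ∘L ((leftReg γ).prodMap (leftReg γ)) ∘L e.toContinuousLinearMap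
  refine le_topologicalClosure_of_invariant (v := v) ?_ (jointGraph_isClosed h.pos.1.isClosed)
    ?_ ?_ ?_ ?_ ?_
  · intro γ x y
    rw [WithLp.prod_inner_apply, WithLp.prod_inner_apply]
    exact congrArg₂ (· + ·) (inner_leftReg_left _ _ _) (inner_leftReg_left _ _ _)
  · rintro γ p ⟨h1, h2⟩
    refine ⟨h.inv _ _ _ h1, ?_⟩
    have := h.inv γ _ _ h2
    rw [← h.comm.adjoint] at this
    exact this
  · rintro p ⟨h1, h2⟩ h0
    rw [h0] at h1 h2
    rw [map_zero] at h2
    exact e.injective (Prod.ext (S.graph_fst_eq_zero_snd h1 rfl) (S.graph_fst_eq_zero_snd h2 rfl))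
  · intro γ p hp
    rw [hspan] at hp ⊢
    exact prodMap_mem_span (a := leftReg γ) (b := v γ) (u := fun a => leftReg a (deltaOne Γ))
      (v := fun a => WithLp.toLp 2 (leftReg a s, leftReg a (reflectConj (U s))))
      (fun a => ⟨γ * a, leftReg_leftReg γ a _,
        e.injective (Prod.ext (leftReg_leftReg γ a _) (leftReg_leftReg γ a _))⟩) hp
  · rw [hspan, Submodule.span_le]
    rintro _ ⟨a, rfl⟩
    refine ⟨h.inv _ _ _ h.mem, ?_⟩
    have := h.inv a _ _ (h.mem_adjoint_deltaOne h.comm)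
    rw [← h.comm.adjoint] at this
    exact this
  · refine dense_range_deltaComb.mono ?_
    rw [deltaComb, Finsupp.range_linearCombination, hspan, Submodule.map_span, ← Set.range_comp]
    rfl

theorem dense_domain_inter (h : IsPolarFactor F S U s) :
    Dense {x | x ∈ F.domain ∧ ∃ A, CommLeft A ∧ A (deltaOne Γ) = x} := by
  let N : Submodule ℂ (EllTwo Γ) :=
    { carrier := {x | x ∈ F.domain ∧ ∃ A, CommLeft A ∧ A (deltaOne Γ) = x}
      zero_mem' := ⟨F.domain.zero_mem, 0, fun _ _ => by simp, rfl⟩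
      add_mem' := by
        rintro _ _ ⟨h1, A, hA, rfl⟩ ⟨h2, B, hB, rfl⟩
        exact ⟨F.domain.add_mem h1 h2, A + B, fun γ x => by simp [hA γ x, hB γ x], rfl⟩
      smul_mem' := by
        rintro c _ ⟨h1, A, hA, rfl⟩
        exact ⟨F.domain.smul_mem c h1, c • A, fun γ x => by simp [hA γ x], rfl⟩ }
  change Dense (N : Set (EllTwo Γ))
  obtain ⟨ε, R, Q, hr, hR, hQ⟩ := exists_resolvent_seq h.pos.1.isClosed h.pos.1.dense_domain
  have hle : LinearMap.range (deltaComb Γ) ≤ N.topologicalClosure := by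
    rw [deltaComb, Finsupp.range_linearCombination, Submodule.span_le]
    rintro _ ⟨γ, rfl⟩
    -- `R k λ(γ) δ_e = R k ρ(γ⁻¹) δ_e` lies in `Dom S² = Dom F` and in the commutant orbit of `δ_e`.
    refine mem_closure_of_tendsto (hR (leftReg γ (deltaOne Γ))) (Eventually.of_forall fun k => ?_)
    refine ⟨LinearPMap.mem_domain_iff.2 ⟨_, (h.mem_graph_iff _ _).2
      ⟨_, (hr k).mem_opComp h.pos.1 _, rfl⟩⟩, R k ∘L rightReg γ⁻¹,
      ((hr k).commLeft h.pos h.inv).1.comp (CommLeft.rightReg _), ?_⟩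
    rw [ContinuousLinearMap.comp_apply, rightReg_deltaOne, inv_inv]
  have := dense_range_deltaComb.mono (show (LinearMap.range (deltaComb Γ) : Set (EllTwo Γ)) ⊆
    closure (N : Set (EllTwo Γ)) from hle)
  exact dense_closure.1 this

/-- If the matrix coefficients of `F` at `δ_e` are those of a unitary representation, then `F` is
positive and selfadjoint. -/
theorem isPosSelfAdjoint (h : IsPolarFactor F S U s) (hF : LeftInv F) (hc : F.IsClosed)
    (hd : Dense (F.domain : Set (EllTwo Γ))) {H : Type*} [NormedAddCommGroup H]
    [InnerProductSpace ℂ H] {Ψ : Γ → H}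
    (hΨ : ∀ a b, inner ℂ (Ψ b) (Ψ a) =
      inner ℂ (leftReg b (reflectConj (U s))) (leftReg a s)) : IsPosSelfAdjoint F := by
  set J := jointCore U s with hJ
  have hfst : ∀ f, (J f).2.fst = Finsupp.linearCombination ℂ (fun a => leftReg a s) f :=
    jointCore_fst
  have hsnd : ∀ f, (J f).2.snd =
      Finsupp.linearCombination ℂ (fun a => leftReg a (reflectConj (U s))) f := jointCore_snd
  -- Over `ℓ₀(Γ)` the form `⟨S U* x, S y⟩` is the Gram form of `Ψ`, hence hermitian and positive;
  -- both properties pass to the closure.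
  have hform : ∀ f g, inner ℂ (J g).2.snd (J f).2.fst =
      inner ℂ (Finsupp.linearCombination ℂ Ψ g) (Finsupp.linearCombination ℂ Ψ f) := fun f g => by
    rw [hfst, hsnd]
    exact (inner_linearCombination_eq hΨ f g).symm
  have c1 : Continuous fun p : EllTwo Γ × WithLp 2 (EllTwo Γ × EllTwo Γ) => p.2.fst :=
    (WithLp.fstL 2 ℂ (EllTwo Γ) (EllTwo Γ)).continuous.comp continuous_snd
  have c2 : Continuous fun p : EllTwo Γ × WithLp 2 (EllTwo Γ × EllTwo Γ) => p.2.snd :=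
    (WithLp.sndL 2 ℂ (EllTwo Γ) (EllTwo Γ)).continuous.comp continuous_snd
  have hJsym : ∀ p ∈ jointGraph S U, ∀ q ∈ jointGraph S U,
      inner ℂ p.2.snd q.2.fst = inner ℂ p.2.fst q.2.snd := by
    have step : ∀ f, ∀ q ∈ jointGraph S U,
        inner ℂ (J f).2.snd q.2.fst = inner ℂ (J f).2.fst q.2.snd := fun f q hq => by
      refine closure_minimal
        (s := (LinearMap.range J : Set (EllTwo Γ × WithLp 2 (EllTwo Γ × EllTwo Γ))))
        (t := {q : EllTwo Γ × WithLp 2 (EllTwo Γ × EllTwo Γ) |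
          inner ℂ (J f).2.snd q.2.fst = inner ℂ (J f).2.fst q.2.snd}) ?_
        (isClosed_eq (continuous_const.inner c1) (continuous_const.inner c2)) (h.jointGraph_le hq)
      rintro _ ⟨g, rfl⟩
      change inner ℂ (J f).2.snd (J g).2.fst = inner ℂ (J f).2.fst (J g).2.snd
      rw [hform, ← inner_conj_symm (J f).2.fst, hform, inner_conj_symm]
    intro p hp q hq
    refine closure_minimal
        (s := (LinearMap.range J : Set (EllTwo Γ × WithLp 2 (EllTwo Γ × EllTwo Γ))))
      (t := {p : EllTwo Γ × WithLp 2 (EllTwo Γ × EllTwo Γ) |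
          inner ℂ p.2.snd q.2.fst = inner ℂ p.2.fst q.2.snd}) ?_
      (isClosed_eq (c2.inner continuous_const) (c1.inner continuous_const)) (h.jointGraph_le hp)
    rintro _ ⟨f, rfl⟩
    exact step f q hq
  have hJpos : ∀ p ∈ jointGraph S U, 0 ≤ (inner ℂ p.2.snd p.2.fst).re := fun p hp => by
    refine closure_minimal
        (s := (LinearMap.range J : Set (EllTwo Γ × WithLp 2 (EllTwo Γ × EllTwo Γ))))
      (t := {p : EllTwo Γ × WithLp 2 (EllTwo Γ × EllTwo Γ) | 0 ≤ (inner ℂ p.2.snd p.2.fst).re}) ?_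
      (isClosed_le continuous_const (Complex.continuous_re.comp (c2.inner c1)))
      (h.jointGraph_le hp)
    rintro _ ⟨f, rfl⟩
    change 0 ≤ (inner ℂ (J f).2.snd (J f).2.fst).re
    rw [hform]
    exact inner_self_nonneg (𝕜 := ℂ)
  let D : Submodule ℂ (EllTwo Γ × EllTwo Γ) :=
    { carrier := {p | p ∈ F.graph ∧ ∃ A, CommLeft A ∧ A (deltaOne Γ) = p.1}
      zero_mem' := ⟨F.graph.zero_mem, 0, fun _ _ => by simp, rfl⟩
      add_mem' := by
        rintro p q ⟨h1, A, hA, hAp⟩ ⟨h2, B, hB, hBq⟩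
        exact ⟨F.graph.add_mem h1 h2, A + B, fun γ x => by simp [hA γ x, hB γ x],
          congrArg₂ (· + ·) hAp hBq⟩
      smul_mem' := by
        rintro c p ⟨h1, A, hA, hAp⟩
        exact ⟨F.graph.smul_mem c h1, c • A, fun γ x => by simp [hA γ x], congrArg (c • ·) hAp⟩ }
  have hDF : F.graph ≤ D.topologicalClosure := by
    refine hF.le_topologicalClosure hc ?_ (fun p hp => hp.1) (h.dense_domain_inter.mono ?_)
    · rintro γ p ⟨h1, A, hA, hAp⟩
      refine ⟨hF _ _ _ h1, A ∘L rightReg γ⁻¹, hA.comp (CommLeft.rightReg _), ?_⟩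
      rw [ContinuousLinearMap.comp_apply, rightReg_deltaOne, inv_inv, hA, hAp]
    · rintro x ⟨hx, A, hA, hAx⟩
      exact ⟨_, ⟨LinearPMap.mem_graph_mk hx, A, hA, hAx⟩, rfl⟩
  -- For `x = A δ_e` in `Dom F`, `U* x` is again in the commutant orbit of `δ_e`, hence in `Dom S`.
  -- Thus `⟨x', F x⟩ = ⟨S U* x', S x⟩` for all `x'` in the joint domain.
  have hDJ : ∀ p ∈ D, ∃ q ∈ jointGraph S U, q.1 = p.1 ∧
      ∀ q' ∈ jointGraph S U, inner ℂ q'.1 p.2 = inner ℂ q'.2.snd q.2.fst := by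
    rintro ⟨x, f⟩ ⟨h1, A, hA, rfl⟩
    obtain ⟨w, hw, rfl⟩ := (h.mem_graph_iff _ _).1 h1
    obtain ⟨q, hq, hqw⟩ := mem_graph_opComp.1 hw
    have hr := h.inv.mem_of_isSelfAdjoint h.pos.1 h.mem (h.comm.adjoint.comp hA)
    refine ⟨(A (deltaOne Γ), WithLp.toLp 2 (q, _)), ⟨hq, hr⟩, rfl, fun q' hq' => ?_⟩
    rw [← ContinuousLinearMap.adjoint_inner_left]
    exact (h.pos.1.mem_graph_iff.1 hqw _ _ hq'.2).symm
  have hDsym : ∀ p ∈ D, ∀ q ∈ D, inner ℂ p.1 q.2 = inner ℂ p.2 q.1 := by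
    intro p hp q hq
    obtain ⟨p', hp', e1, e2⟩ := hDJ p hp
    obtain ⟨q', hq', e3, e4⟩ := hDJ q hq
    rw [← inner_conj_symm p.2, ← e1, ← e3, e4 _ hp', e2 _ hq', hJsym _ hp' _ hq', inner_conj_symm]
  refine isPosSelfAdjoint_of_formal hF hc hd (fun p hp q hq => ?_) fun p hp => ?_
  · refine closure_minimal (s := (D : Set (EllTwo Γ × EllTwo Γ)))
      (t := {p : EllTwo Γ × EllTwo Γ | inner ℂ p.1 q.2 = inner ℂ p.2 q.1})
      (fun p hp => ?_) (isClosed_eq (continuous_fst.inner continuous_const)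
        (continuous_snd.inner continuous_const)) (hDF hp)
    exact closure_minimal (s := (D : Set (EllTwo Γ × EllTwo Γ)))
      (t := {q : EllTwo Γ × EllTwo Γ | inner ℂ p.1 q.2 = inner ℂ p.2 q.1})
      (fun q hq => hDsym p hp q hq) (isClosed_eq (continuous_const.inner continuous_snd)
        (continuous_const.inner continuous_fst)) (hDF hq)
  · refine closure_minimal (s := (D : Set (EllTwo Γ × EllTwo Γ)))
      (t := {p : EllTwo Γ × EllTwo Γ | 0 ≤ (inner ℂ p.1 p.2).re})
      (fun p hp => ?_) (isClosed_le continuous_const (Complex.continuous_re.comp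
        (continuous_fst.inner continuous_snd))) (hDF hp)
    obtain ⟨p', hp', e1, e2⟩ := hDJ p hp
    change 0 ≤ (inner ℂ p.1 p.2).re
    rw [← e1, e2 _ hp']
    exact hJpos _ hp'

end IsPolarFactor

end SelfAdjoint

/-! ### Finitely supported sequences and the synthesis operator. -/

section FiniteSupport

variable {Γ : Type*} [Group Γ]

theorem deltaComb_apply (f : Γ →₀ ℂ) (x : Γ) : deltaComb Γ f x = f x := by
  classical
  induction f using Finsupp.induction_linear with
  | zero => rw [map_zero]; rfl
  | add f g hf hg => rw [map_add, Finsupp.add_apply, ← hf, ← hg]; rfl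
  | single a c =>
    rw [deltaComb, Finsupp.linearCombination_single]
    change c • leftReg a (deltaOne Γ) x = _
    rw [leftReg_apply, deltaOne_apply, Finsupp.single_apply, inv_mul_eq_one]
    split_ifs <;> simp

theorem range_deltaComb : LinearMap.range (deltaComb Γ) = ellZero Γ := by
  ext c
  constructor
  · rintro ⟨f, rfl⟩
    refine f.hasFiniteSupport.subset fun x hx => ?_
    rwa [Function.mem_support, deltaComb_apply] at hx
  · intro hc
    refine ⟨Finsupp.ofSupportFinite c hc, ?_⟩
    ext x
    rw [deltaComb_apply]
    rfl

theorem dense_ellZero : Dense (ellZero Γ : Set (EllTwo Γ)) :=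
  range_deltaComb (Γ := Γ) ▸ dense_range_deltaComb

theorem leftReg_mem_ellZero (γ : Γ) {c : EllTwo Γ} (hc : c ∈ ellZero Γ) :
    leftReg γ c ∈ ellZero Γ :=
  Set.Finite.preimage (Equiv.mulLeft γ⁻¹).injective.injOn hc

theorem mem_graph_synthesis {H : Type*} [NormedAddCommGroup H] [InnerProductSpace ℂ H]
    {Ψ : Γ → H} {c : EllTwo Γ} {t : H} : (c, t) ∈ (synthesis Ψ).graph ↔
      ∃ f, deltaComb Γ f = c ∧ Finsupp.linearCombination ℂ Ψ f = t := by
  have key : ∀ (f : Γ →₀ ℂ) (h : deltaComb Γ f ∈ (synthesis Ψ).domain),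
      synthesis Ψ ⟨deltaComb Γ f, h⟩ = Finsupp.linearCombination ℂ Ψ f := fun f h => by
    change ∑ᶠ j, deltaComb Γ f j • Ψ j = _
    simp only [deltaComb_apply]
    rw [Finsupp.linearCombination_apply]
    refine finsum_eq_sum_of_support_subset _ fun x hx => ?_
    rw [Finset.mem_coe, Finsupp.mem_support_iff]
    intro h0
    exact hx (by simp [h0])
  rw [LinearPMap.mem_graph_pair]
  constructor
  · rintro ⟨h, rfl⟩
    have h' : c ∈ ellZero Γ := h
    rw [← range_deltaComb] at h'
    obtain ⟨f, rfl⟩ := h'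
    exact ⟨f, rfl, (key f h).symm⟩
  · rintro ⟨f, rfl, rfl⟩
    have h : deltaComb Γ f ∈ ellZero Γ := range_deltaComb (Γ := Γ) ▸ ⟨f, rfl⟩
    exact ⟨h, key f h⟩

end FiniteSupport

/-! ### The Gramian compared with the bracket. -/

section Gram

variable {Γ : Type*} [Group Γ] {F S : EllTwo Γ →ₗ.[ℂ] EllTwo Γ} {s : EllTwo Γ}
  {H : Type*} [NormedAddCommGroup H] [InnerProductSpace ℂ H] [CompleteSpace H] {Ψ : Γ → H}

/-- `F = S²` with `S` positive selfadjoint, commuting with the left regular representation, and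
`S δ_e = s` a vector whose orbit has the same Gram matrix as `Ψ`. -/
structure IsGramFactor (Ψ : Γ → H) (F S : EllTwo Γ →ₗ.[ℂ] EllTwo Γ) (s : EllTwo Γ) : Prop where
  pos : IsPosSelfAdjoint S
  inv : LeftInv S
  mem : (deltaOne Γ, s) ∈ S.graph
  sq : opComp S S = F
  inner_eq : ∀ a b, inner ℂ (Ψ b) (Ψ a) = inner ℂ (leftReg b s) (leftReg a s)

theorem MemLOne.isPosSelfAdjoint_and_exists_isGramFactor (hF : MemLOne F)
    {π : Γ →* unitary (H →L[ℂ] H)} {ψ : H}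
    (ht : ∀ γ, HasTrace (opComp F (bddOp (rightReg γ))) (inner ℂ ((π γ : H →L[ℂ] H) ψ) ψ)) :
    IsPosSelfAdjoint F ∧ ∃ S s, IsGramFactor (orbitFamily π ψ) F S s := by
  have hinv := hF.1.leftInv
  have hc := hF.1.closed
  have hd := hF.1.dense
  obtain ⟨P, hP, S, hS, hδ⟩ := exists_of_oneNorm_lt_top hF.2
  obtain ⟨U, hU⟩ := hP.exists_isPolarFactor hinv hc hd hS hδ
  set s := S ⟨deltaOne Γ, hδ⟩
  have horb : ∀ a b, inner ℂ (orbitFamily π ψ b) (orbitFamily π ψ a) =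
      inner ℂ ((π (a⁻¹ * b) : H →L[ℂ] H) ψ) ψ := fun a b => by
    have h1 : (π b : H →L[ℂ] H) ψ = (π a : H →L[ℂ] H) ((π (a⁻¹ * b) : H →L[ℂ] H) ψ) := by
      rw [← mul_apply_eq_comp, ← Submonoid.coe_mul, ← map_mul, mul_inv_cancel_left]
    rw [orbitFamily, orbitFamily, h1, ← ContinuousLinearMap.adjoint_inner_left,
      ← ContinuousLinearMap.star_eq_adjoint, ← mul_apply_eq_comp,
      Unitary.coe_star_mul_self]
    rfl
  have hform : ∀ U : EllTwo Γ →L[ℂ] EllTwo Γ, IsPolarFactor F S U s → ∀ a b,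
      inner ℂ (orbitFamily π ψ b) (orbitFamily π ψ a) =
        inner ℂ (leftReg b (reflectConj (U s))) (leftReg a s) := fun U hU a b => by
    rw [horb, (ht _).eq_inner hU hinv hc hd, inner_leftReg_left, leftReg_leftReg, mul_inv_rev,
      inv_inv]
  have hpos := hU.isPosSelfAdjoint hinv hc hd (hform U hU)
  -- A positive `F` is its own absolute value. The factorization may then be taken with `U = 1`, and
  -- `s* = s` removes the involution from the Gram matrix identity.
  have hFP : F = P := IsOpSqrt.unique (P := opComp F.adjoint F)
    ⟨hpos, by rw [LinearPMap.isSelfAdjoint_def.1 hpos.1]⟩ hP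
  have hsq : opComp S S = F := hFP ▸ hS.2
  have h1 : IsPolarFactor F S 1 s :=
    ⟨hU.pos, hU.inv, CommLeft.one, fun _ => le_rfl, hU.mem, fun x f => by
      rw [hsq]
      exact ⟨fun h => ⟨f, h, rfl⟩, fun ⟨p, h, e⟩ => e ▸ h⟩⟩
  refine ⟨hpos, S, s, hU.pos, hU.inv, hU.mem, hsq, fun a b => ?_⟩
  have e : reflectConj s = s := by
    refine S.graph_functional ?_ hU.mem
    have := hU.inv.mem_of_isSelfAdjoint hU.pos.1 hU.mem CommLeft.one
    rwa [← ContinuousLinearMap.star_eq_adjoint, star_one] at this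
  rw [hform 1 h1]
  change inner ℂ (leftReg b (reflectConj s)) _ = _
  rw [e]

theorem synthesis_dense : Dense ((synthesis Ψ).domain : Set (EllTwo Γ)) := dense_ellZero

namespace IsGramFactor

theorem leftInv (h : IsGramFactor Ψ F S s) : LeftInv F := h.sq ▸ h.inv.opComp h.inv

theorem mem_graph (h : IsGramFactor Ψ F S s) (f : Γ →₀ ℂ) :
    (deltaComb Γ f, Finsupp.linearCombination ℂ (fun a => leftReg a s) f) ∈ S.graph := by
  induction f using Finsupp.induction_linear with
  | zero => rw [map_zero, map_zero]; exact S.graph.zero_mem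
  | add f g hf hg => rw [map_add, map_add]; exact S.graph.add_mem hf hg
  | single a c =>
    rw [deltaComb, Finsupp.linearCombination_single, Finsupp.linearCombination_single]
    exact S.graph.smul_mem c (h.inv _ _ _ h.mem)

/-- `T_Ψ` and the restriction of `S` to `ℓ₀(Γ)` have the same Gram form, so `T_Ψ* T_Ψ` can be
computed with the latter. As `ℓ₀(Γ)` is a core of `S`, the adjoint of that restriction is `S`
itself. -/
theorem mem_graph_preGramian (h : IsGramFactor Ψ F S s) {c z : EllTwo Γ} :
    (c, z) ∈ (preGramian Ψ).graph ↔ c ∈ ellZero Γ ∧ (c, z) ∈ F.graph := by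
  rw [preGramian, mem_graph_opComp, ← h.sq, mem_graph_opComp]
  constructor
  · rintro ⟨t, hct, htz⟩
    obtain ⟨f, rfl, rfl⟩ := mem_graph_synthesis.1 hct
    refine ⟨range_deltaComb (Γ := Γ) ▸ ⟨f, rfl⟩, _, h.mem_graph f, h.pos.1.mem_graph_iff.2 ?_⟩
    intro x w hxw
    rw [mem_graph_adjoint synthesis_dense] at htz
    have hclosed : IsClosed {p : EllTwo Γ × EllTwo Γ |
        inner ℂ p.2 (Finsupp.linearCombination ℂ (fun a => leftReg a s) f) = inner ℂ p.1 z} :=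
      isClosed_eq (continuous_snd.inner continuous_const) (continuous_fst.inner continuous_const)
    refine closure_minimal (fun p hp => ?_) hclosed
      (h.inv.graph_le_span h.pos.1.isClosed h.mem hxw)
    obtain ⟨g, rfl⟩ := (Finsupp.mem_span_range_iff_exists_finsupp).1 hp
    have e1 : (g.sum fun i a => a • (leftReg i (deltaOne Γ), leftReg i s)) =
        (deltaComb Γ g, Finsupp.linearCombination ℂ (fun a => leftReg a s) g) := by
      rw [deltaComb, Finsupp.linearCombination_apply, Finsupp.linearCombination_apply,
        Finsupp.sum, Finsupp.sum, Finsupp.sum]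
      exact Prod.ext (Prod.fst_sum) (Prod.snd_sum)
    rw [e1]
    change inner ℂ (Finsupp.linearCombination ℂ _ g) (Finsupp.linearCombination ℂ _ f) =
      inner ℂ (deltaComb Γ g) z
    rw [← inner_linearCombination_eq h.inner_eq, ← htz _ _ (mem_graph_synthesis.2 ⟨g, rfl, rfl⟩)]
  · rintro ⟨hc, q, hcq, hqz⟩
    rw [← range_deltaComb] at hc
    obtain ⟨f, rfl⟩ := hc
    refine ⟨_, mem_graph_synthesis.2 ⟨f, rfl, rfl⟩, ?_⟩
    rw [mem_graph_adjoint synthesis_dense]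
    intro x w hxw
    obtain ⟨g, rfl, rfl⟩ := mem_graph_synthesis.1 hxw
    rw [inner_linearCombination_eq h.inner_eq, S.graph_functional (h.mem_graph f) hcq]
    exact h.pos.1.mem_graph_iff.1 hqz _ _ (h.mem_graph g)

theorem isClosed (h : IsGramFactor Ψ F S s) (hF : F.IsClosed) : (gramian Ψ).IsClosed :=
  (hF.isClosable.leIsClosable (LinearPMap.le_of_le_graph fun _ hp =>
    (h.mem_graph_preGramian.1 hp).2)).closure_isClosed

/-- The Gramian is a closed invariant restriction of `F`, so a dense domain forces equality by
maximality. -/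
theorem eq_gramian (h : IsGramFactor Ψ F S s) (hF : F.IsClosed)
    (hd : Dense ((gramian Ψ).domain : Set (EllTwo Γ))) : gramian Ψ = F := by
  have hle : (preGramian Ψ).graph ≤ F.graph := fun _ hp => (h.mem_graph_preGramian.1 hp).2
  have hcl : (preGramian Ψ).IsClosable :=
    hF.isClosable.leIsClosable (LinearPMap.le_of_le_graph hle)
  have hgr : (preGramian Ψ).graph.topologicalClosure = (gramian Ψ).graph :=
    hcl.graph_closure_eq_closure_graph
  refine LeftInv.eq_of_le (fun γ x y hxy => ?_) hcl.closure_isClosed hd h.leftInv hF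
    (LinearPMap.le_of_le_graph ?_)
  · rw [← hgr] at hxy ⊢
    refine map_mem_closure (s := ((preGramian Ψ).graph : Set _))
      (t := ((preGramian Ψ).graph : Set _)) ((leftReg γ).prodMap (leftReg γ)).continuous hxy ?_
    rintro ⟨c, z⟩ hp
    obtain ⟨h1, h2⟩ := h.mem_graph_preGramian.1 hp
    exact h.mem_graph_preGramian.2 ⟨leftReg_mem_ellZero γ h1, h.leftInv _ _ _ h2⟩
  · rw [← hgr]
    exact Submodule.topologicalClosure_minimal _ hle hF

theorem ellZero_le (h : IsGramFactor Ψ F S s) (hδ : deltaOne Γ ∈ F.domain) :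
    ellZero Γ ≤ (preGramian Ψ).domain := by
  have hle : ellZero Γ ≤ F.domain := by
    rw [← range_deltaComb, deltaComb, Finsupp.range_linearCombination, Submodule.span_le]
    rintro _ ⟨γ, rfl⟩
    exact LinearPMap.mem_domain_of_mem_graph (h.leftInv γ _ _ (LinearPMap.mem_graph_mk hδ))
  exact fun c hc => LinearPMap.mem_domain_of_mem_graph
    (h.mem_graph_preGramian.2 ⟨hc, LinearPMap.mem_graph_mk (hle hc)⟩)

/-- Bounded operators intertwining the left regular representation and `π`, and mapping `δ_e` to
vectors close to a given one. -/
theorem exists_intertwining {π : Γ →* unitary (H →L[ℂ] H)} {ψ : H}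
    (h : IsGramFactor (orbitFamily π ψ) F S s) {η : ℝ} (hη : 0 < η) :
    ∃ Θ : EllTwo Γ →L[ℂ] H, (∀ γ x, Θ (leftReg γ x) = (π γ : H →L[ℂ] H) (Θ x)) ∧
      dist ψ (Θ (deltaOne Γ)) < η := by
  have horb : ∀ γ a, (π γ : H →L[ℂ] H) (orbitFamily π ψ a) = orbitFamily π ψ (γ * a) := by
    intro γ a
    rw [orbitFamily, orbitFamily, map_mul, Submonoid.coe_mul, mul_apply_eq_comp]
  have hinv : ∀ γ, ∀ p ∈ Submodule.span ℂ (Set.range fun a => (leftReg a s, orbitFamily π ψ a)),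
      (leftReg γ p.1, (π γ : H →L[ℂ] H) p.2) ∈
        Submodule.span ℂ (Set.range fun a => (leftReg a s, orbitFamily π ψ a)) := fun γ p hp =>
    prodMap_mem_span (a := leftReg γ) (b := (π γ : H →L[ℂ] H)) (u := fun a => leftReg a s)
      (v := orbitFamily π ψ) (fun a => ⟨γ * a, leftReg_leftReg γ a _, horb γ a⟩) hp
  -- Equality of the Gram matrices makes `λ(a)s ↦ π(a)ψ` a well-defined isometric relation.
  obtain ⟨V, hV, -, hVc⟩ := exists_contraction_of_relation
    (Submodule.span ℂ (Set.range fun a => (leftReg a s, orbitFamily π ψ a))) (by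
      intro p hp
      obtain ⟨g, rfl⟩ := (Finsupp.mem_span_range_iff_exists_finsupp).1 hp
      have e : (g.sum fun i a => a • (leftReg i s, orbitFamily π ψ i)) =
          (Finsupp.linearCombination ℂ (fun a => leftReg a s) g,
            Finsupp.linearCombination ℂ (orbitFamily π ψ) g) := by
        rw [Finsupp.linearCombination_apply, Finsupp.linearCombination_apply,
          Finsupp.sum, Finsupp.sum, Finsupp.sum]
        exact Prod.ext (Prod.fst_sum) (Prod.snd_sum)
      rw [e, norm_eq_sqrt_re_inner (𝕜 := ℂ), norm_eq_sqrt_re_inner (𝕜 := ℂ),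
        inner_linearCombination_eq h.inner_eq])
  have hVs : V s = ψ := by
    have : V (leftReg 1 s) = orbitFamily π ψ 1 := hV _ (Submodule.subset_span ⟨1, rfl⟩)
    rw [leftReg_one, orbitFamily, map_one] at this
    exact this
  obtain ⟨ε, R, Q, hr, -, hQ⟩ := exists_resolvent_seq h.pos.1.isClosed h.pos.1.dense_domain
  have hlim : Tendsto (fun k => V (Q k (deltaOne Γ))) atTop (𝓝 ψ) := by
    rw [← hVs]
    exact (V.continuous.tendsto s).comp (hQ _ _ h.mem)
  obtain ⟨k, hk⟩ := (hlim.eventually (Metric.ball_mem_nhds ψ hη)).exists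
  -- `Q k` is a bounded substitute for `S`, and `V Q k δ_e → V s = ψ`.
  refine ⟨V ∘L Q k, fun γ x => ?_, by rwa [dist_comm]⟩
  rw [ContinuousLinearMap.comp_apply, ((hr k).commLeft h.pos h.inv).2,
    hVc (leftReg γ) (π γ : H →L[ℂ] H) (hinv γ) (fun p hp => ⟨_, by
      rw [leftReg_adjoint]
      exact hinv γ⁻¹ p hp⟩), ContinuousLinearMap.comp_apply]

end IsGramFactor

/-- The synthesis operator is the restriction of `Θ` to the dense subspace `ℓ₀(Γ)`, so its adjoint
is the bounded operator `Θ*`. -/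
theorem gramian_eq_bddOp {Θ : EllTwo Γ →L[ℂ] H} (hΨ : ∀ a, Ψ a = Θ (leftReg a (deltaOne Γ))) :
    gramian Ψ = bddOp (Θ.adjoint ∘L Θ) := by
  have hsyn : synthesis Ψ = (Θ : EllTwo Γ →ₗ[ℂ] H).toPMap (ellZero Γ) := by
    refine LinearPMap.eq_of_mem_graph_iff fun c t => ?_
    have e : ∀ f, Finsupp.linearCombination ℂ Ψ f = Θ (deltaComb Γ f) := fun f => by
      rw [funext hΨ, deltaComb]
      exact (Finsupp.apply_linearCombination ℂ (Θ : EllTwo Γ →ₗ[ℂ] H) _ f).symm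
    rw [mem_graph_synthesis, LinearPMap.mem_graph_pair]
    constructor
    · rintro ⟨f, rfl, rfl⟩
      exact ⟨range_deltaComb (Γ := Γ) ▸ ⟨f, rfl⟩, (e f).symm⟩
    · rintro ⟨hc, rfl⟩
      have hc' : c ∈ ellZero Γ := hc
      rw [← range_deltaComb] at hc'
      obtain ⟨f, rfl⟩ := hc'
      exact ⟨f, rfl, e f⟩
  have hadj : (synthesis Ψ).adjoint = bddOp Θ.adjoint := by
    rw [hsyn]
    exact Θ.toPMap_adjoint_eq_adjoint_toPMap_of_dense dense_ellZero
  have hpre : ∀ c z, (c, z) ∈ (preGramian Ψ).graph ↔ c ∈ ellZero Γ ∧ Θ.adjoint (Θ c) = z := by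
    intro c z
    rw [preGramian, mem_graph_opComp, hadj, hsyn]
    simp only [mem_graph_bddOp]
    constructor
    · rintro ⟨t, h1, rfl⟩
      obtain ⟨hc, rfl⟩ := LinearPMap.mem_graph_pair.1 h1
      exact ⟨hc, rfl⟩
    · rintro ⟨hc, rfl⟩
      exact ⟨Θ c, LinearPMap.mem_graph_pair.2 ⟨hc, rfl⟩, rfl⟩
  have hle : (preGramian Ψ).graph ≤ (bddOp (Θ.adjoint ∘L Θ)).graph := fun p hp =>
    mem_graph_bddOp.2 ((hpre p.1 p.2).1 hp).2
  have hcl : (preGramian Ψ).IsClosable :=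
    (bddOp_isClosed _).isClosable.leIsClosable (LinearPMap.le_of_le_graph hle)
  have hgr : (preGramian Ψ).graph.topologicalClosure = (gramian Ψ).graph :=
    hcl.graph_closure_eq_closure_graph
  refine LinearPMap.eq_of_eq_graph (le_antisymm ?_ ?_)
  · rw [← hgr]
    exact Submodule.topologicalClosure_minimal _ hle (bddOp_isClosed _)
  · rintro ⟨x, y⟩ hxy
    rw [← hgr]
    rw [mem_graph_bddOp] at hxy
    subst hxy
    refine dense_ellZero.induction (P := fun x => (x, (Θ.adjoint ∘L Θ) x) ∈
      (preGramian Ψ).graph.topologicalClosure) (fun c hc => ?_) ?_ x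
    · exact Submodule.le_topologicalClosure _ ((hpre _ _).2 ⟨hc, rfl⟩)
    · exact (Submodule.isClosed_topologicalClosure _).preimage
        (continuous_id.prodMk (Θ.adjoint ∘L Θ).continuous)

theorem bddOp_isPosSelfAdjoint {K : Type*} [NormedAddCommGroup K] [InnerProductSpace ℂ K]
    [CompleteSpace K] {B : K →L[ℂ] K} (hB : B.IsPositive) : IsPosSelfAdjoint (bddOp B) := by
  refine ⟨LinearPMap.isSelfAdjoint_def.2 ?_, fun x => hB.re_inner_nonneg_right x⟩
  rw [bddOp_adjoint, ← ContinuousLinearMap.star_eq_adjoint, hB.isSelfAdjoint.star_eq]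

theorem twoNorm_bddOp_lt_top {B : EllTwo Γ →L[ℂ] EllTwo Γ} (hB : B.IsPositive) :
    twoNorm (bddOp B) < ∞ := by
  have hp := bddOp_isPosSelfAdjoint hB
  refine ENNReal.rpow_lt_top_of_nonneg (by norm_num) (ne_of_lt ?_)
  refine lt_of_le_of_lt (iInf₂_le_of_le (bddOp B) ⟨hp, ?_⟩ (iInf_le _ Submodule.mem_top))
    (ENNReal.pow_lt_top enorm_lt_top)
  rw [LinearPMap.isSelfAdjoint_def.1 hp.1]

/-- A positive `F` is the unique root of `F*F`, and a finite trace of `F*F` means that `δ_e` is in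
the domain of that root. -/
theorem deltaOne_mem_domain_of_twoNorm_lt_top (hF : IsPosSelfAdjoint F) (h : twoNorm F < ∞) :
    deltaOne Γ ∈ F.domain := by
  rw [twoNorm, ENNReal.rpow_lt_top_iff_of_pos (by norm_num)] at h
  simp only [posTrace, iInf_lt_iff] at h
  obtain ⟨S, hS, hδ, -⟩ := h
  rwa [hS.unique (S' := F) ⟨hF, by rw [LinearPMap.isSelfAdjoint_def.1 hF.1]⟩] at hδ

end Gram

end

/-! ### The three assertions of the theorem. -/

theorem theorem4p1 {Γ : Type*} [Group Γ] [Countable Γ]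
    {H : Type*} [NormedAddCommGroup H] [InnerProductSpace ℂ H] [CompleteSpace H]
    [TopologicalSpace.SeparableSpace H]
    (π : Γ →* unitary (H →L[ℂ] H)) (br : H → H → (EllTwo Γ →ₗ.[ℂ] EllTwo Γ))
    (hbr : IsBracket π br) :
    (∀ ψ : H, (gramian (orbitFamily π ψ)).IsClosed →
      Dense ((gramian (orbitFamily π ψ)).domain : Set (EllTwo Γ)) →
      MemLOne (gramian (orbitFamily π ψ)) ∧ br ψ ψ = gramian (orbitFamily π ψ)) ∧
    (∀ ψ : H, MemLTwo (br ψ ψ) →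
      ellZero Γ ≤ (preGramian (orbitFamily π ψ)).domain ∧
      (gramian (orbitFamily π ψ)).IsClosed ∧
      Dense ((gramian (orbitFamily π ψ)).domain : Set (EllTwo Γ))) ∧
    Dense {ψ : H | MemLTwo (br ψ ψ) ∧ br ψ ψ = gramian (orbitFamily π ψ)} := by

  have hfac := fun ψ => (hbr.mem ψ ψ).isPosSelfAdjoint_and_exists_isGramFactor (hbr.trace ψ ψ)
  have hi : ∀ ψ : H, Dense ((gramian (orbitFamily π ψ)).domain : Set (EllTwo Γ)) →
      gramian (orbitFamily π ψ) = br ψ ψ := fun ψ hd => by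
    obtain ⟨-, S, s, h⟩ := hfac ψ
    exact h.eq_gramian (hbr.mem ψ ψ).1.closed hd
  refine ⟨fun ψ _ hd => ?_, fun ψ h2 => ?_, fun ψ => ?_⟩
  · rw [hi ψ hd]
    exact ⟨hbr.mem ψ ψ, rfl⟩
  · obtain ⟨hpos, S, s, h⟩ := hfac ψ
    have hle := h.ellZero_le (deltaOne_mem_domain_of_twoNorm_lt_top hpos h2.2)
    exact ⟨hle, h.isClosed h2.1.closed,
      dense_ellZero.mono (hle.trans (LinearPMap.le_closure _).1)⟩
  · rw [Metric.mem_closure_iff]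
    intro η hη
    obtain ⟨-, S, s, h⟩ := hfac ψ
    obtain ⟨Θ, hΘ, hdist⟩ := h.exists_intertwining hη
    have hg : gramian (orbitFamily π (Θ (deltaOne Γ))) = bddOp (Θ.adjoint ∘L Θ) :=
      gramian_eq_bddOp fun a => (hΘ a _).symm
    -- The approximating vector has an everywhere defined Gramian, so (i) identifies its bracket
    -- with the bounded positive operator `Θ*Θ`.
    have hbrg := hi (Θ (deltaOne Γ)) (hg ▸ bddOp_dense _)
    refine ⟨Θ (deltaOne Γ), ⟨⟨(hbr.mem _ _).1, ?_⟩, hbrg.symm⟩, hdist⟩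
    rw [← hbrg, hg]
    exact twoNorm_bddOp_lt_top (ContinuousLinearMap.isPositive_adjoint_comp_self Θ)
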